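/- Conventions. Let $n\ge 0$, $[n]=\{1,\dots,n\}$, and let $\mathcal H=([n],\mathcal E)$ be a hypergraph, where $\mathcal E$ is a set of nonempty subsets of $[n]$. For $m\le n$, $\mathcal H_m$ is the hypergraph on $[m]$ whose hyperedges are the $A\in\mathcal E$ with $A\subseteq[m]$. $\mathcal H$ is in *hyperfect elimination order* if $n=0$, or if $n\ge1$ and (i) for all (not necessarily distinct) $A,B\in\mathcal E$ with $n\in A\cap B$ and all distinct $a\in A\setminus\{n\}$, $b\in B\setminus\{n\}$ there is $X\in\mathcal E$ with $\{a,b\}\subseteq X\subseteq (A\cup B)\setminus\{n\}$, and (ii) $\mathcal H_{n-1}$ is in hyperfect elimination order. An *orientation* of $\mathcal H$ is a map $h:\mathcal E\to[n]$ with $h(A)\in A$ for all $A$. It is *acyclic* if the digraph with an arc $i\to j$ for all $i\ne j$ such that $i,j\in A$ and $h(A)=j$ for some $A\in\mathcal E$ has no directed cycle; the transitive closure of the arcs is then a strict partial order $\prec$ on $[n]$, defining a poset $P_h$. Let $AO_{\mathcal H}$ be the set of acyclic orientations. An orientation $h'\neq h$ arises from $h$ by the *pair flip* $(i,j)$, $i\ne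 j$, if $h'(A)=i$ whenever $h(A)=j$ and $i\in A$, and $h'(A)=h(A)$ otherwise. The *flip graph* on $AO_{\mathcal H}$ joins two acyclic orientations that differ in a pair flip. Encoding. Suppose $\mathcal H$ is in hyperfect elimination order. For $h\in AO_{\mathcal H}$ define a permutation $\pi_h$ of $[n]$ in one-line notation: it is empty if $n=0$. If $n\ge1$, let $h_{n-1}$ be the restriction of $h$ to $\mathcal H_{n-1}$; then $\pi_h$ arises from $\pi_{h_{n-1}}$ by inserting $n$ at the last position if $n$ is maximal in $P_h$, otherwise at the first position if $n$ is minimal in $P_h$, and otherwise directly to the left of the (then unique) element covering $n$ in $P_h$. Let $\Pi_{\mathcal H}=\{\pi_h : h\in AO_{\mathcal H}\}$. Algorithm J. Let $L$ be a set of permutations of $[n]$. A *right jump* of the value $v$ by $d\geq 1$ steps moves $v$ to the right over the next $d$ entries, all of which must be smaller than $v$; left jumps are defined symmetrically. A jump is *minimal* with respect to $L$ if every jump of the same value in the same direction by fewer steps gives a permutation not in $L$. Algorithm J on $L$, started at the identity permutation $\mathrm{id}_n\in L$, first visits $\mathrm{id}_n$ and then repeats: among the minimal jumps (with respect to $L$)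 in the most recently visited permutation that lead to an unvisited permutation in $L$, take one of the largest possible value and visit its result; terminate if there is no such jump or if for this largest value there are such jumps in both directions. Polytope. For $S\subseteq[n]$ let $\Delta_S=\mathrm{conv}\{e_i: i\in S\}\subseteq\mathbb R^n$, and let $Z(\mathcal H)=\sum_{A\in\mathcal E}\Delta_A$ (Minkowski sum) be the *hypergraphic polytope*. Its *skeleton* is the graph on its vertices in which two distinct vertices are adjacent if the segment between them is a face. For an orientation $h$ let $\delta_h\in\mathbb R^n$ be its in-degree sequence, $\delta_h(i)=|\{A\in\mathcal E: h(A)=i\}|$. **Theorem.** Let $\mathcal H=([n],\mathcal E)$ be a hypergraph with nonempty hyperedges that is in hyperfect elimination order. Then $\mathrm{id}_n\in\Pi_{\mathcal H}$, and the sequence of permutations visited by Algorithm J on $\Pi_{\mathcal H}$, started at $\mathrm{id}_n$, is $\pi_{h_1},\pi_{h_2},\dots,\pi_{h_N}$ for a sequence $h_1,\dots,h_N$ that is a Hamilton path in the flip graph on $AO_{\mathcal H}$ (every acyclic orientation occurs exactly once, and consecutive ones differ in a pair flip). Moreover, $h\mapsto\delta_h$ is an isomorphism from the flip graph onto the skeleton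 of $Z(\mathcal H)$, so that equivalently $\delta_{h_1},\dots,\delta_{h_N}$ is a Hamilton path in the skeleton of $Z(\mathcal H)$. -/

import Mathlib

namespace HypergraphGray

open scoped Pointwise

/-! A hypergraph `([n], E)` is a `Hypergraph ℕ` whose vertex set is `Set.Icc 1 n`, that is,
`{1, …, n}`. -/

/-- The subhypergraph induced by the vertices in `{1, …, m}`: its hyperedges are the hyperedges
contained in `{1, …, m}`. -/
def restrict (H : Hypergraph ℕ) (m : ℕ) : Hypergraph ℕ where
  vertexSet := H.vertexSet ∩ Set.Icc 1 m
  edgeSet := {A | A ∈ H.edgeSet ∧ A ⊆ Set.Icc 1 m}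
  subset_vertexSet_of_mem_edgeSet' := fun _ hA =>
    Set.subset_inter (H.subset_vertexSet_of_mem_edgeSet' hA.1) hA.2

/-- The hypergraph `H` on `{1, …, n}` is in hyperfect elimination order.  The hyperedges `A`
and `B` may be equal. -/
def IsHEO : ℕ → Hypergraph ℕ → Prop
  | 0, _ => True
  | n + 1, H =>
    (∀ A ∈ H.edgeSet, ∀ B ∈ H.edgeSet, n + 1 ∈ A ∩ B →
      ∀ a ∈ A \ {n + 1}, ∀ b ∈ B \ {n + 1}, a ≠ b →
        ∃ X ∈ H.edgeSet, {a, b} ⊆ X ∧ X ⊆ (A ∪ B) \ {n + 1}) ∧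
    IsHEO n (restrict H n)

/-! ### Orientations -/

/-- An orientation chooses a head `h A ∈ A` for every hyperedge `A`. -/
abbrev Orientation (H : Hypergraph ℕ) : Type :=
  (A : H.edgeSet) → (A : Set ℕ)

/-- The arcs `i → j` of the digraph of an orientation: `i ≠ j` lie in a common hyperedge
with head `j`. -/
def Arc {H : Hypergraph ℕ} (h : Orientation H) (i j : ℕ) : Prop :=
  i ≠ j ∧ ∃ A : H.edgeSet, i ∈ A.1 ∧ (h A : ℕ) = j

/-- The transitive closure of the arcs.  For acyclic `h` this is the strict order of the
poset of `h`. -/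
def Prec {H : Hypergraph ℕ} (h : Orientation H) : ℕ → ℕ → Prop :=
  Relation.TransGen (Arc h)

/-- The orientation is acyclic: its digraph has no directed cycle. -/
def IsAcyclic {H : Hypergraph ℕ} (h : Orientation H) : Prop :=
  ∀ i : ℕ, ¬ Prec h i i

/-- The set of acyclic orientations of `H`. -/
abbrev AO (H : Hypergraph ℕ) : Type :=
  {h : Orientation H // IsAcyclic h}

open Classical in
/-- `h'` is obtained from `h` by the pair flip `(i, j)`: all hyperedges with head `j` that
contain `i` get the head `i`, and at least one head changes. -/
def IsPairFlip {H : Hypergraph ℕ} (i j : ℕ) (h h' : Orientation H) : Prop :=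
  i ∈ H.vertexSet ∧ j ∈ H.vertexSet ∧ i ≠ j ∧ h ≠ h' ∧
    ∀ A, (h' A : ℕ) = if (h A : ℕ) = j ∧ i ∈ A.1 then i else (h A : ℕ)

/-- The flip graph: two acyclic orientations are adjacent if they differ in a pair flip. -/
def flipGraph (H : Hypergraph ℕ) : SimpleGraph (AO H) :=
  SimpleGraph.fromRel (fun h h' => ∃ i j : ℕ, IsPairFlip i j h.1 h'.1)

/-! ### The encoding by permutations

A permutation `a₁ ⋯ aₙ` of `{1, …, n}` is represented in one-line notation, by the list
`[a₁, …, aₙ]`. -/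

/-- The identity permutation `1 2 ⋯ n`. -/
def idPerm (n : ℕ) : List ℕ := List.range' 1 n

theorem Arc.of_restrict {H : Hypergraph ℕ} {m : ℕ} (h : Orientation H) {i j : ℕ}
    (hij : Arc (H := restrict H m) (fun A => h ⟨A.1, A.2.1⟩) i j) : Arc h i j := by
  obtain ⟨hne, A, hi, hj⟩ := hij
  exact ⟨hne, ⟨A.1, A.2.1⟩, hi, hj⟩

/-- The restriction of an acyclic orientation to the hyperedges contained in `{1, …, m}`. -/
def AO.restrict {H : Hypergraph ℕ} (h : AO H) (m : ℕ) : AO (HypergraphGray.restrict H m) :=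
  ⟨fun A => h.1 ⟨A.1, A.2.1⟩, fun i hi =>
    h.2 i (Relation.TransGen.mono (fun _ _ hab => Arc.of_restrict h.1 hab) i i hi)⟩

/-- `j` covers `i` in the poset of `h`. -/
def Covers {H : Hypergraph ℕ} (h : Orientation H) (j i : ℕ) : Prop :=
  Prec h i j ∧ ¬ ∃ k : ℕ, Prec h i k ∧ Prec h k j

open Classical in
/-- The permutation of an acyclic orientation of a hypergraph on `{1, …, n}`.  The largest
vertex is put last if it is maximal in the poset, otherwise first if it is minimal, and
otherwise directly to the left of the vertex that covers it (that vertex exists, and in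
hyperfect elimination order it is the only one). -/
noncomputable def encode : (n : ℕ) → {H : Hypergraph ℕ} → AO H → List ℕ
  | 0, _, _ => []
  | n + 1, _, h =>
    if ¬ ∃ j, Prec h.1 (n + 1) j then
      encode n (h.restrict n) ++ [n + 1]
    else if ¬ ∃ j, Prec h.1 j (n + 1) then
      (n + 1) :: encode n (h.restrict n)
    else
      (encode n (h.restrict n)).insertIdx
        ((encode n (h.restrict n)).idxOf (Classical.epsilon fun b => Covers h.1 b (n + 1)))
        (n + 1)

/-- The encoding of an acyclic orientation is a permutation of `{1, …, n}`. -/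
theorem encode_perm (n : ℕ) {H : Hypergraph ℕ} (h : AO H) :
    (encode n h).Perm (List.range' 1 n) := by
  induction n generalizing H with
  | zero => simp [encode]
  | succ n ih =>
    have key : ((n + 1) :: encode n (h.restrict n)).Perm (List.range' 1 (n + 1)) := by
      rw [List.range'_concat, Nat.one_mul, Nat.add_comm 1 n]
      exact ((ih (h.restrict n)).cons _).trans (List.perm_append_singleton _ _).symm
    unfold encode
    split
    · exact (List.perm_append_singleton _ _).trans key
    · split
      · exact key
      · exact (List.perm_insertIdx _ _ List.idxOf_le_length).trans key

/-- The set of all permutations that encode acyclic orientations of `H`, where `H` is a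
hypergraph on `{1, …, n}`. -/
def encodings (n : ℕ) (H : Hypergraph ℕ) : Set (List ℕ) :=
  Set.range (fun h : AO H => encode n h)

/-! ### Greedy minimal jumps -/

inductive Direction where
  | left
  | right

/-- `π'` is obtained from `π` by a jump of the value `v` by `d` steps in a given direction. -/
def IsJump (v : ℕ) (dir : Direction) (d : ℕ) (π π' : List ℕ) : Prop :=
  0 < d ∧ ∃ x s y : List ℕ, s.length = d ∧ (∀ b ∈ s, b < v) ∧
    match dir with
    | Direction.right => π = x ++ [v] ++ s ++ y ∧ π' = x ++ s ++ [v] ++ y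
    | Direction.left => π = x ++ s ++ [v] ++ y ∧ π' = x ++ [v] ++ s ++ y

/-- A jump that is minimal with respect to `L`: jumps of the same value in the same direction
by fewer steps leave `L`. -/
def IsMinimalJump (L : Set (List ℕ)) (v : ℕ) (dir : Direction) (π π' : List ℕ) : Prop :=
  ∃ d : ℕ, IsJump v dir d π π' ∧ ∀ d' < d, ∀ π'' : List ℕ, IsJump v dir d' π π'' → π'' ∉ L

/-- A minimal jump of the value `v` that leads to an unvisited permutation `π'` in `L`. -/
def IsCandidate (L : Set (List ℕ)) (visited : List (List ℕ)) (π : List ℕ)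
    (v : ℕ) (dir : Direction) (π' : List ℕ) : Prop :=
  IsMinimalJump L v dir π π' ∧ π' ∈ L ∧ π' ∉ visited

/-- One jump step of the greedy algorithm, from the most recently visited `π` to `π'`: the
value that jumps is the largest possible one, and its jump direction is not ambiguous. -/
def IsStep (L : Set (List ℕ)) (visited : List (List ℕ)) (π π' : List ℕ) : Prop :=
  ∃ (v : ℕ) (dir : Direction), IsCandidate L visited π v dir π' ∧
    (∀ w > v, ∀ dir' π'', ¬ IsCandidate L visited π w dir' π'') ∧
    (∀ dir' ≠ dir, ∀ π'', ¬ IsCandidate L visited π v dir' π'')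

/-- `out` is the complete sequence of permutations that the greedy algorithm visits on the
input `L` with initial permutation `π₀ ∈ L`: it starts with `π₀`, each further permutation
comes from the previous one by a jump step, where the visited permutations are all those
listed before, and it stops when no jump step is possible. -/
def IsAlgorithmJOutput (L : Set (List ℕ)) (π₀ : List ℕ) (out : List (List ℕ)) : Prop :=
  π₀ ∈ L ∧ out.head? = some π₀ ∧
    (∀ pre π π' post, out = pre ++ [π, π'] ++ post → IsStep L (pre ++ [π]) π π') ∧
    (∀ pre π, out = pre ++ [π] → ∀ π', ¬ IsStep L out π π')

/-! ### Hamilton paths and polytopes -/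

open Classical in
/-- The sequence `l` of vertices is a Hamilton path of `G`. -/
def IsHamiltonPath {V : Type*} (G : SimpleGraph V) (l : List V) : Prop :=
  ∃ (u v : V) (p : G.Walk u v), p.IsHamiltonian ∧ p.support = l

/-- The skeleton of a polytope `P`: the vertices are the extreme points of `P`, and two of
them are adjacent if the segment between them is a face of `P`. -/
def skeleton {E : Type*} [AddCommGroup E] [Module ℝ E] [TopologicalSpace E] (P : Set E) :
    SimpleGraph (P.extremePoints ℝ) where
  Adj x y := x ≠ y ∧ IsExposed ℝ P (segment ℝ x.1 y.1)
  symm := ⟨fun x y hxy => ⟨hxy.1.symm, by rw [segment_symm]; exact hxy.2⟩⟩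
  loopless := ⟨fun _ hx => hx.1 rfl⟩

/-- The standard simplex `Δ_S` in `ℝⁿ`, the convex hull of the unit vectors `e_i` with
`i ∈ S`. -/
def simplex (n : ℕ) (S : Set ℕ) : Set (Set.Icc 1 n → ℝ) :=
  convexHull ℝ {x | ∃ i : Set.Icc 1 n, i.1 ∈ S ∧ x = Pi.single i 1}

/-- The hypergraphic polytope in `ℝⁿ` of a hypergraph on `{1, …, n}`: the Minkowski sum of the
simplices of all (finitely many) hyperedges. -/
noncomputable def polytope (n : ℕ) (H : Hypergraph ℕ) : Set (Set.Icc 1 n → ℝ) :=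
  ∑ᶠ A : H.edgeSet, simplex n A

/-- The in-degree sequence of an orientation: coordinate `i` counts the hyperedges with
head `i`. -/
noncomputable def inDegree (n : ℕ) {H : Hypergraph ℕ} (h : Orientation H) : Set.Icc 1 n → ℝ :=
  fun i => ({A : H.edgeSet | (h A : ℕ) = i.1}.ncard : ℝ)

end HypergraphGray

namespace HypergraphGray

/-! ### Jumps -/

/-! The encoding $\pi_h$ is a linear extension of $P_h$: every hyperedge has its head at its last
vertex in $\pi_h$ (`compatible_encode`). Hence $\pi_h$ determines $h$, and conversely any ordering
of the vertices gives an acyclic orientation. The elimination order enters through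
`IsHyperfect.exists_edge`: a head of a hyperedge through the largest vertex and another member of
such a hyperedge share a hyperedge that avoids the largest vertex and whose head is under control.
This makes the cover of the largest vertex unique and inserting to its left safe
(`exists_encode_succ`).

Consequently the encodings form a zigzag language (`exists_isZigzag`): deleting the largest value
gives the encoding of the restriction, reinserting it in the last position is always possible, and
either the first position is always possible too or the last one is the only one. By induction, the
run of Algorithm J arises from the run for the restriction by replacing each permutation with a
sweep of the largest value through its possible positions, in alternating directions
(`IsZigzag.isAlgorithmJOutput`). During a sweep the unvisited positions lie on one side. After a
sweep the largest value is stuck at an end, where it does not obstruct smaller values, so the next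
jump is the one made for the restriction. Steps are deterministic, so this run is the only one.

Neighbours in the run differ in a pair flip. In a sweep, all changed hyperedges must lose or gain
the largest vertex as head in exchange for one and the same vertex, since otherwise an intermediate
position would be possible (`flipRel_of_consecutive`). Between sweeps, a flip of the restriction
lifts to the same pair (`IsPairFlip.extend`).

For the polytope, $\delta_h$ is the sum of the unit vectors at the heads. Extreme points of a
Minkowski sum decompose uniquely into extreme points of the summands. A directed cycle gives a
second decomposition, while for acyclic $h$ the number of predecessors is a weight maximized only at
$\delta_h$; so the vertices are the $\delta_h$ with $h$ acyclic. On an exposed segment every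
admissible change of one head is parallel to the segment, which forces a pair flip. Conversely,
nothing lies between the two vertices of a flip, so the poset with these two merged still yields a
weight, and its maximal face is the segment. -/

theorem insertIdx_length_append (x y : List ℕ) (v : ℕ) :
    (x ++ y).insertIdx x.length v = x ++ v :: y := by
  induction x with
  | nil => simp
  | cons a x ih => simpa using ih

theorem insertIdx_eq_take_drop {l : List ℕ} {p : ℕ} (hp : p ≤ l.length) (v : ℕ) :
    l.insertIdx p v = l.take p ++ v :: l.drop p := by
  have := insertIdx_length_append (l.take p) (l.drop p) v
  rwa [List.take_append_drop, List.length_take, min_eq_left hp] at this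

theorem isJump_left_iff {v d : ℕ} {π π' : List ℕ} :
    IsJump v .left d π π' ↔ IsJump v .right d π' π := by
  simp only [IsJump, and_comm (a := π = _)]

theorem IsJump.perm {v d : ℕ} {dir : Direction} {π π' : List ℕ} (h : IsJump v dir d π π') :
    π'.Perm π := by
  have key : ∀ {π π'}, IsJump v .right d π π' → π'.Perm π := by
    rintro _ _ ⟨-, x, s, y, -, -, rfl, rfl⟩
    simp only [List.append_assoc]
    exact (List.perm_append_left_iff x).2 (by
      rw [← List.append_assoc, ← List.append_assoc]
      exact List.Perm.append_right y List.perm_append_comm)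
  cases dir with
  | right => exact key h
  | left => exact (key (isJump_left_iff.1 h)).symm

theorem IsJump.mem {v d : ℕ} {dir : Direction} {π π' : List ℕ} (h : IsJump v dir d π π') :
    v ∈ π := by
  obtain ⟨-, x, s, y, -, -, h⟩ := h
  cases dir <;> simp [h.1]

theorem append_cons_inj {x t x' t' : List ℕ} {v : ℕ} (hn : (x ++ v :: t).Nodup)
    (h : x ++ v :: t = x' ++ v :: t') : x = x' ∧ t = t' := by
  have := List.nodup_middle.1 hn
  simp only [List.nodup_cons, List.mem_append, not_or] at this
  obtain ⟨hx, -, hy⟩ := (List.append_cons_inj_of_notMem this.1.1 this.1.2).1 h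
  exact ⟨hx, hy⟩

theorem IsJump.right_unique {v d : ℕ} {dir : Direction} {π π₁ π₂ : List ℕ} (hπ : π.Nodup)
    (h₁ : IsJump v dir d π π₁) (h₂ : IsJump v dir d π π₂) : π₁ = π₂ := by
  obtain ⟨-, x, s, y, hs, -, h⟩ := h₁
  obtain ⟨-, x', s', y', hs', -, h'⟩ := h₂
  cases dir with
  | right =>
    obtain ⟨rfl, rfl⟩ := h
    obtain ⟨h, rfl⟩ := h'
    simp only [List.append_assoc, List.cons_append, List.nil_append] at h hπ
    obtain ⟨hx, hy⟩ := append_cons_inj hπ h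
    obtain ⟨rfl, rfl⟩ := List.append_inj hy (by omega)
    rw [hx]
  | left =>
    obtain ⟨rfl, rfl⟩ := h
    obtain ⟨h, rfl⟩ := h'
    rw [List.append_assoc] at hπ h
    rw [List.append_assoc _ _ y'] at h
    obtain ⟨hx, hy⟩ := append_cons_inj hπ h
    obtain ⟨rfl, rfl⟩ := List.append_inj' hx (by omega)
    rw [show y = y' from hy]

/-- Jumps of the largest value. -/
theorem isJump_insertIdx_iff {n d p : ℕ} {dir : Direction} {π z : List ℕ}
    (hπ : ∀ a ∈ π, a < n + 1) (hp : p ≤ π.length) :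
    IsJump (n + 1) dir d (π.insertIdx p (n + 1)) z ↔
      0 < d ∧ ∃ q ≤ π.length, z = π.insertIdx q (n + 1) ∧
        match dir with
        | .right => q = p + d
        | .left => p = q + d := by
  have hn : n + 1 ∉ π := fun h => absurd (hπ _ h) (by omega)
  refine and_congr_right fun hd => ?_
  cases dir with
  | right =>
    constructor
    · rintro ⟨x, s, y, hs, hlt, h, rfl⟩
      rw [insertIdx_eq_take_drop hp] at h
      simp only [List.append_assoc, List.cons_append, List.nil_append] at h
      obtain ⟨hx, -, hy⟩ := (List.append_cons_inj_of_notMem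
        (fun h => hn (List.mem_of_mem_take h)) (fun h => hn (List.mem_of_mem_drop h))).1 h
      have hl : π = (x ++ s) ++ y := by
        rw [← List.take_append_drop p π, hx, hy, List.append_assoc]
      have hxl : x.length = p := by rw [← hx, List.length_take, min_eq_left hp]
      refine ⟨p + d, ?_, ?_, rfl⟩
      · rw [hl]; simp; omega
      · have := insertIdx_length_append (x ++ s) y (n + 1)
        rw [List.length_append, hxl, hs, ← hl] at this
        rw [this]; simp
    · rintro ⟨q, hq, rfl, rfl⟩
      refine ⟨π.take p, (π.drop p).take d, π.drop (p + d), by simp; omega,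
        fun b hb => hπ b (List.mem_of_mem_drop (List.mem_of_mem_take hb)), ?_, ?_⟩
      · rw [insertIdx_eq_take_drop hp, List.append_assoc, ← List.drop_drop, List.take_append_drop]
        simp
      · rw [insertIdx_eq_take_drop hq, List.take_add]; simp
  | left =>
    constructor
    · rintro ⟨x, s, y, hs, hlt, h, rfl⟩
      rw [insertIdx_eq_take_drop hp, List.append_assoc] at h
      simp only [List.singleton_append] at h
      obtain ⟨hx, -, hy⟩ := (List.append_cons_inj_of_notMem
        (fun h => hn (List.mem_of_mem_take h)) (fun h => hn (List.mem_of_mem_drop h))).1 h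
      have hl : π = x ++ (s ++ y) := by
        rw [← List.take_append_drop p π, hx, hy, List.append_assoc]
      have hxl : x.length + d = p := by
        rw [← hs, ← List.length_append, ← hx, List.length_take, min_eq_left hp]
      refine ⟨x.length, by omega, ?_, hxl.symm⟩
      rw [hl, insertIdx_length_append]; simp
    · rintro ⟨q, hq, rfl, rfl⟩
      refine ⟨π.take q, (π.drop q).take d, π.drop (q + d), by simp; omega,
        fun b hb => hπ b (List.mem_of_mem_drop (List.mem_of_mem_take hb)), ?_, ?_⟩
      · rw [insertIdx_eq_take_drop hp, List.take_add]; simp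
      · rw [insertIdx_eq_take_drop hq, List.append_assoc, ← List.drop_drop, List.take_append_drop]
        simp

/-- A jump passes only over entries smaller than `v`, so a leading `n + 1` is never passed and stays
in front. -/
theorem isJump_cons_iff {n v d : ℕ} {dir : Direction} {π z : List ℕ} (hv : v < n + 1) :
    IsJump v dir d ((n + 1) :: π) z ↔ ∃ π', z = (n + 1) :: π' ∧ IsJump v dir d π π' := by
  constructor
  · rintro ⟨hd, x, s, y, hs, hlt, h⟩
    cases dir with
    | right =>
      obtain ⟨h, rfl⟩ := h
      cases x with
      | nil => simp at h; omega
      | cons a x =>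
        simp only [List.cons_append, List.cons.injEq] at h
        obtain ⟨rfl, rfl⟩ := h
        exact ⟨_, rfl, hd, x, s, y, hs, hlt, rfl, rfl⟩
    | left =>
      obtain ⟨h, rfl⟩ := h
      cases x with
      | nil =>
        cases s with
        | nil => simp at hs; omega
        | cons b s =>
          simp only [List.nil_append, List.cons_append, List.cons.injEq] at h
          have := hlt b (by simp)
          omega
      | cons a x =>
        simp only [List.cons_append, List.cons.injEq] at h
        obtain ⟨rfl, rfl⟩ := h
        exact ⟨_, rfl, hd, x, s, y, hs, hlt, rfl, rfl⟩
  · rintro ⟨π', rfl, hd, x, s, y, hs, hlt, h⟩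
    refine ⟨hd, (n + 1) :: x, s, y, hs, hlt, ?_⟩
    cases dir <;> simp [h]

theorem isJump_concat_iff {n v d : ℕ} {dir : Direction} {π z : List ℕ} (hv : v < n + 1) :
    IsJump v dir d (π ++ [n + 1]) z ↔ ∃ π', z = π' ++ [n + 1] ∧ IsJump v dir d π π' := by
  constructor
  · rintro ⟨hd, x, s, y, hs, hlt, h⟩
    cases dir with
    | right =>
      obtain ⟨h, rfl⟩ := h
      rcases List.eq_nil_or_concat y with rfl | ⟨y, a, rfl⟩
      · rcases List.eq_nil_or_concat s with rfl | ⟨s, b, rfl⟩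
        · simp at hs; omega
        · rw [List.append_nil, List.concat_eq_append, ← List.append_assoc] at h
          obtain ⟨-, h⟩ := List.append_inj' h rfl
          have := hlt b (by simp)
          simp at h; omega
      · rw [List.concat_eq_append, ← List.append_assoc] at h
        obtain ⟨rfl, h⟩ := List.append_inj' h rfl
        obtain rfl : n + 1 = a := by simpa using h
        exact ⟨x ++ s ++ [v] ++ y, by simp, hd, x, s, y, hs, hlt, rfl, rfl⟩
    | left =>
      obtain ⟨h, rfl⟩ := h
      rcases List.eq_nil_or_concat y with rfl | ⟨y, a, rfl⟩
      · rw [List.append_nil] at h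
        obtain ⟨-, h⟩ := List.append_inj' h rfl
        simp at h; omega
      · rw [List.concat_eq_append, ← List.append_assoc] at h
        obtain ⟨rfl, h⟩ := List.append_inj' h rfl
        obtain rfl : n + 1 = a := by simpa using h
        exact ⟨x ++ [v] ++ s ++ y, by simp, hd, x, s, y, hs, hlt, rfl, rfl⟩
  · rintro ⟨π', rfl, hd, x, s, y, hs, hlt, h⟩
    refine ⟨hd, x, s, y ++ [n + 1], hs, hlt, ?_⟩
    cases dir <;> simp [h]

/-- Jumps of smaller values when the largest value is in the first or the last position. -/
theorem isJump_insertIdx_of_lt {n v d e : ℕ} {dir : Direction} {π z : List ℕ} (hv : v < n + 1)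
    (hπ : π.length = n) (he : e = 0 ∨ e = n) :
    IsJump v dir d (π.insertIdx e (n + 1)) z ↔
      ∃ π', z = π'.insertIdx e (n + 1) ∧ IsJump v dir d π π' := by
  rcases he with rfl | rfl
  · simpa using isJump_cons_iff hv
  · have : ∀ π' : List ℕ, π'.length = e → π'.insertIdx e (e + 1) = π' ++ [e + 1] := by
      intro π' h
      have := insertIdx_length_append π' [] (e + 1)
      rwa [List.append_nil, h] at this
    rw [this π hπ, isJump_concat_iff hv]
    refine exists_congr fun π' => and_congr_left fun h => ?_
    rw [this π' (h.perm.length_eq.trans hπ)]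

/-! ### Determinism of the greedy algorithm -/

/-- Of two jumps of different lengths, the shorter lands in `L` and so destroys the minimality of
the longer. -/
theorem IsMinimalJump.right_unique {L : Set (List ℕ)} {v : ℕ} {dir : Direction}
    {π π₁ π₂ : List ℕ} (hπ : π.Nodup) (h₁ : IsMinimalJump L v dir π π₁)
    (h₂ : IsMinimalJump L v dir π π₂) (hL₁ : π₁ ∈ L) (hL₂ : π₂ ∈ L) : π₁ = π₂ := by
  obtain ⟨d, hd, hm⟩ := h₁
  obtain ⟨d', hd', hm'⟩ := h₂
  rcases lt_trichotomy d d' with h | rfl | h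
  · exact absurd hL₁ (hm' d h _ hd)
  · exact hd.right_unique hπ hd'
  · exact absurd hL₂ (hm d' h _ hd')

theorem IsStep.right_unique {L : Set (List ℕ)} {visited : List (List ℕ)} {π π₁ π₂ : List ℕ}
    (hπ : π.Nodup) (h₁ : IsStep L visited π π₁) (h₂ : IsStep L visited π π₂) : π₁ = π₂ := by
  obtain ⟨v, dir, hc, hv, hdir⟩ := h₁
  obtain ⟨v', dir', hc', hv', hdir'⟩ := h₂
  obtain rfl : v = v' := by
    rcases lt_trichotomy v v' with h | h | h
    · exact absurd hc' (hv _ h _ _)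
    · exact h
    · exact absurd hc (hv' _ h _ _)
  obtain rfl : dir = dir' := by
    by_contra h
    exact hdir' dir h _ hc
  exact hc.1.right_unique hπ hc'.1 hc.2.1 hc'.2.1

theorem IsAlgorithmJOutput.unique {L : Set (List ℕ)} {π₀ : List ℕ} {out out' : List (List ℕ)}
    (hL : ∀ π ∈ L, π.Nodup) (h : IsAlgorithmJOutput L π₀ out)
    (h' : IsAlgorithmJOutput L π₀ out') : out = out' := by
  have memL : ∀ {o}, IsAlgorithmJOutput L π₀ o → ∀ pre π post, o = pre ++ π :: post → π ∈ L := by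
    intro o ho pre π post e
    rcases List.eq_nil_or_concat pre with rfl | ⟨pre, ρ, rfl⟩
    · have := ho.2.1
      rw [e] at this
      obtain rfl : π = π₀ := by simpa using this
      exact ho.1
    · obtain ⟨v, dir, hc, -⟩ := ho.2.2.1 pre ρ π post (by simp [e])
      exact hc.2.1
  -- Runs that agree up to `π` have the same visited list there, so they make the same next step,
  -- and neither can stop while the other continues.
  have key : ∀ suf pre suf' π, out = pre ++ π :: suf → out' = pre ++ π :: suf' →
      suf = suf' := by
    intro suf
    induction suf with
    | nil =>
      intro pre suf' π e e'
      cases suf' with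
      | nil => rfl
      | cons ρ suf' =>
        have := h'.2.2.1 pre π ρ suf' (by simp [e'])
        rw [← e] at this
        exact absurd this (h.2.2.2 pre π e ρ)
    | cons ρ suf ih =>
      intro pre suf' π e e'
      have hs := h.2.2.1 pre π ρ suf (by simp [e])
      cases suf' with
      | nil =>
        rw [← e'] at hs
        exact absurd hs (h'.2.2.2 pre π e' ρ)
      | cons ρ' suf' =>
        obtain rfl := hs.right_unique (hL _ (memL h _ _ _ e))
          (h'.2.2.1 pre π ρ' suf' (by simp [e']))
        rw [ih (pre ++ [π]) suf' ρ (by simp [e]) (by simp [e'])]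
  cases out with
  | nil => simpa using h.2.1
  | cons π suf =>
    cases out' with
    | nil => simpa using h'.2.1
    | cons π' suf' =>
      obtain rfl : π = π₀ := by simpa using h.2.1
      obtain rfl : π' = π := by simpa using h'.2.1
      rw [key suf [] suf' π' rfl rfl]

/-! ### Zigzag sequences -/

open Classical in
/-- The positions, in increasing order, at which the value `n + 1` can be inserted into `π` to
give a member of `L`. -/
noncomputable def positions (L : Set (List ℕ)) (n : ℕ) (π : List ℕ) : List ℕ :=
  (List.range (n + 1)).filter fun p => π.insertIdx p (n + 1) ∈ L

/-- The positions in increasing order, or in decreasing order if `b` is `true`. -/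
noncomputable def orderedPositions (L : Set (List ℕ)) (n : ℕ) (b : Bool) (π : List ℕ) : List ℕ :=
  if b then (positions L n π).reverse else positions L n π

/-- Insert the value `n + 1` into the given lists at all possible positions, in alternating
order. -/
noncomputable def zigzag (L : Set (List ℕ)) (n : ℕ) : Bool → List (List ℕ) → List (List ℕ)
  | _, [] => []
  | b, π :: l => (orderedPositions L n b π).map (fun p => π.insertIdx p (n + 1)) ++ zigzag L n (!b) l

variable {L L' : Set (List ℕ)} {n : ℕ}

theorem mem_orderedPositions {b : Bool} {π : List ℕ} {p : ℕ} :
    p ∈ orderedPositions L n b π ↔ p ≤ n ∧ π.insertIdx p (n + 1) ∈ L := by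
  cases b <;> simp [orderedPositions, positions]

theorem pairwise_orderedPositions (b : Bool) (π : List ℕ) :
    (orderedPositions L n b π).Pairwise fun p q => if b then q < p else p < q := by
  have : (positions L n π).Pairwise (· < ·) := List.pairwise_lt_range.filter _
  cases b
  · simpa [orderedPositions] using this
  · simpa [orderedPositions, List.pairwise_reverse] using this

theorem not_between_of_consecutive {b : Bool} {π B₁ B₂ : List ℕ} {p p' q : ℕ}
    (h : orderedPositions L n b π = B₁ ++ p :: p' :: B₂) (hq : q ≤ n)
    (hqL : π.insertIdx q (n + 1) ∈ L) : ¬ (if b then p' < q ∧ q < p else p < q ∧ q < p') := by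
  have := (mem_orderedPositions (b := b)).2 ⟨hq, hqL⟩
  have hpw := pairwise_orderedPositions (L := L) (n := n) b π
  rw [h, List.pairwise_append, List.pairwise_cons, List.pairwise_cons] at hpw
  obtain ⟨-, ⟨-, hp'B, -⟩, hB₁⟩ := hpw
  simp only [h, List.mem_append, List.mem_cons] at this
  rcases this with hq | rfl | rfl | hq
  · have := hB₁ q hq p (by simp)
    cases b <;> simp at this ⊢ <;> omega
  · cases b <;> simp
  · cases b <;> simp
  · have := hp'B q hq
    cases b <;> simp at this ⊢ <;> omega

theorem mem_zigzag {b : Bool} {l : List (List ℕ)} {x : List ℕ} :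
    x ∈ zigzag L n b l ↔ x ∈ L ∧ ∃ π ∈ l, ∃ p ≤ n, x = π.insertIdx p (n + 1) := by
  induction l generalizing b with
  | nil => simp [zigzag]
  | cons π l ih =>
    simp only [zigzag, List.mem_append, List.mem_map, mem_orderedPositions, ih, List.mem_cons]
    constructor
    · rintro (⟨p, ⟨hp, hL⟩, rfl⟩ | ⟨hL, π', hπ', p, hp, rfl⟩)
      · exact ⟨hL, π, .inl rfl, p, hp, rfl⟩
      · exact ⟨hL, π', .inr hπ', p, hp, rfl⟩
    · rintro ⟨hL, π', rfl | hπ', p, hp, rfl⟩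
      · exact .inl ⟨p, ⟨hp, hL⟩, rfl⟩
      · exact .inr ⟨hL, π', hπ', p, hp, rfl⟩

/-- Locates an entry by its block, the one of `π` with direction `b'`, and by its place `p` in the
block. The last two equations describe what is visited once the block is finished and what remains,
the next block having the opposite direction. -/
theorem zigzag_split {b : Bool} {l : List (List ℕ)} {pre suf : List (List ℕ)} {x : List ℕ}
    (h : zigzag L n b l = pre ++ x :: suf) :
    ∃ l₁ π l₂ B₁ p B₂ b', l = l₁ ++ π :: l₂ ∧ orderedPositions L n b' π = B₁ ++ p :: B₂ ∧
      pre = zigzag L n b l₁ ++ B₁.map (fun p => π.insertIdx p (n + 1)) ∧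
      x = π.insertIdx p (n + 1) ∧
      pre ++ [x] ++ B₂.map (fun p => π.insertIdx p (n + 1)) = zigzag L n b (l₁ ++ [π]) ∧
      suf = B₂.map (fun p => π.insertIdx p (n + 1)) ++ zigzag L n (!b') l₂ := by
  induction l generalizing b pre with
  | nil => simp [zigzag] at h
  | cons π l ih =>
    rw [zigzag] at h
    rcases List.append_eq_append_iff.1 h with ⟨as, h₁, h₂⟩ | ⟨bs, h₁, h₂⟩
    · obtain ⟨l₁, π', l₂, B₁, p, B₂, b', rfl, hB, rfl, rfl, h₃, rfl⟩ := ih h₂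
      refine ⟨π :: l₁, π', l₂, B₁, p, B₂, b', rfl, hB, ?_, rfl, ?_, rfl⟩
      · rw [h₁, zigzag, List.append_assoc]
      · rw [List.cons_append, zigzag, ← h₃, h₁]
        simp
    · cases bs with
      | nil =>
        obtain ⟨l₁, π', l₂, B₁, p, B₂, b', rfl, hB, h₄, rfl, h₃, rfl⟩ := ih (pre := []) h₂.symm
        simp only [List.append_nil] at h₁
        refine ⟨π :: l₁, π', l₂, B₁, p, B₂, b', rfl, hB, ?_, rfl, ?_, rfl⟩
        · rw [← h₁, zigzag, List.append_assoc, ← h₄, List.append_nil]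
        · rw [List.cons_append, zigzag, ← h₃, h₁]
          simp
      | cons y bs =>
        rw [List.cons_append, List.cons.injEq] at h₂
        obtain ⟨rfl, rfl⟩ := h₂
        obtain ⟨B₁, B', hB, rfl, h₄⟩ := List.map_eq_append_iff.1 h₁
        obtain ⟨p, B₂, rfl, rfl, rfl⟩ := List.map_eq_cons_iff.1 h₄
        refine ⟨[], π, l, B₁, p, B₂, b, rfl, hB, by simp [zigzag], rfl, ?_, rfl⟩
        simp [zigzag, hB]

theorem insertIdx_succ_inj {π π' : List ℕ} {p p' : ℕ} (h' : n + 1 ∉ π')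
    (hp : p ≤ π.length) (hp' : p' ≤ π'.length)
    (e : π.insertIdx p (n + 1) = π'.insertIdx p' (n + 1)) : π = π' ∧ p = p' := by
  rw [insertIdx_eq_take_drop hp, insertIdx_eq_take_drop hp'] at e
  obtain ⟨h₁, -, h₂⟩ := (List.append_cons_inj_of_notMem
    (fun hm => h' (List.mem_of_mem_take hm)) (fun hm => h' (List.mem_of_mem_drop hm))).1 e.symm
  refine ⟨by rw [← List.take_append_drop p π, ← List.take_append_drop p' π', h₁, h₂], ?_⟩
  have := congrArg List.length h₁
  rw [List.length_take, List.length_take] at this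
  omega

theorem IsAlgorithmJOutput.nodup {π₀ : List ℕ} {out : List (List ℕ)}
    (h : IsAlgorithmJOutput L π₀ out) : out.Nodup := by
  suffices ∀ pre suf, out = pre ++ suf → pre.Nodup from this out [] (by simp)
  intro pre
  induction pre using List.reverseRecOn with
  | nil => simp
  | append_singleton pre x ih =>
    intro suf e
    rw [List.nodup_append_comm, List.singleton_append, List.nodup_cons]
    refine ⟨?_, ih (x :: suf) (by simp [e])⟩
    rcases List.eq_nil_or_concat pre with rfl | ⟨pre, y, rfl⟩
    · simp
    · obtain ⟨v, dir, hc, -⟩ := h.2.2.1 pre y x suf (by simp [e])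
      simpa using hc.2.2

/-- The sets `L'` and `L` of permutations of `{1, …, n}` and `{1, …, n + 1}` are consecutive in
a zigzag language: `L` arises from `L'` by insertions of `n + 1`.  The first possible position
is `c`, which is first or last, and the last position is always possible. -/
structure IsZigzag (n : ℕ) (L' L : Set (List ℕ)) (c : ℕ) : Prop where
  perm : ∀ π ∈ L', π.Perm (List.range' 1 n)
  exists_insertIdx : ∀ x ∈ L, ∃ π ∈ L', ∃ p ≤ n, x = π.insertIdx p (n + 1)
  first_or_last : c = 0 ∨ c = n
  first_le : ∀ π ∈ L', ∀ p, π.insertIdx p (n + 1) ∈ L → c ≤ p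
  first_mem : ∀ π ∈ L', π.insertIdx c (n + 1) ∈ L
  last_mem : ∀ π ∈ L', π.insertIdx n (n + 1) ∈ L

/-! ### Steps of Algorithm J along a zigzag sequence -/

namespace IsZigzag

variable {c : ℕ} {π : List ℕ} {b : Bool}

theorem length_eq (hz : IsZigzag n L' L c) (hπ : π ∈ L') : π.length = n := by
  simpa using (hz.perm π hπ).length_eq

theorem lt_of_mem (hz : IsZigzag n L' L c) (hπ : π ∈ L') {a : ℕ} (ha : a ∈ π) : a < n + 1 := by
  have := (hz.perm π hπ).mem_iff.1 ha
  simp only [List.mem_range'_1] at this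
  omega

theorem succ_notMem (hz : IsZigzag n L' L c) (hπ : π ∈ L') : n + 1 ∉ π :=
  fun h => absurd (hz.lt_of_mem hπ h) (lt_irrefl _)

theorem le_last (hz : IsZigzag n L' L c) : c ≤ n := by
  rcases hz.first_or_last with h | h <;> omega

theorem eq_of_insertIdx_eq (hz : IsZigzag n L' L c) {π' : List ℕ} (hπ : π ∈ L') (hπ' : π' ∈ L')
    {p p' : ℕ} (hp : p ≤ n) (hp' : p' ≤ n)
    (e : π.insertIdx p (n + 1) = π'.insertIdx p' (n + 1)) : π = π' ∧ p = p' :=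
  insertIdx_succ_inj (hz.succ_notMem hπ') (by rwa [hz.length_eq hπ])
    (by rwa [hz.length_eq hπ']) e

theorem endpoint_mem (hz : IsZigzag n L' L c) (hπ : π ∈ L') (b b' : Bool) :
    (if b then c else n) ∈ orderedPositions L n b' π := by
  rw [mem_orderedPositions]
  cases b
  · exact ⟨le_rfl, hz.last_mem π hπ⟩
  · exact ⟨hz.le_last, hz.first_mem π hπ⟩

/-- A decreasing block (`b = true`) ends at the smallest possible position `c`, an increasing one at
`n`. Together with `eq_endpoint_of_head`, this shows that each block starts at the position where
the preceding one ended. -/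
theorem eq_endpoint_of_last (hz : IsZigzag n L' L c) (hπ : π ∈ L') {B : List ℕ} {p : ℕ}
    (h : orderedPositions L n b π = B ++ [p]) : p = if b then c else n := by
  have hmem := hz.endpoint_mem hπ b b
  have hp : p ∈ orderedPositions L n b π := by simp [h]
  have hpw := pairwise_orderedPositions (L := L) (n := n) b π
  rw [h, List.pairwise_append] at hpw
  rw [h, List.mem_append] at hmem
  rw [mem_orderedPositions] at hp
  rcases hmem with hmem | hmem
  · have := hpw.2.2 _ hmem p (by simp)
    have hc := hz.first_le π hπ p hp.2
    cases b <;> simp at this <;> omega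
  · exact (List.mem_singleton.1 hmem).symm

theorem eq_endpoint_of_head (hz : IsZigzag n L' L c) (hπ : π ∈ L') {B : List ℕ} {p : ℕ}
    (h : orderedPositions L n (!b) π = p :: B) : p = if b then c else n := by
  have hmem := hz.endpoint_mem hπ b (!b)
  have hp : p ∈ orderedPositions L n (!b) π := by simp [h]
  have hpw := pairwise_orderedPositions (L := L) (n := n) (!b) π
  rw [h, List.pairwise_cons] at hpw
  rw [h, List.mem_cons] at hmem
  rw [mem_orderedPositions] at hp
  rcases hmem with hmem | hmem
  · exact hmem.symm
  · have := hpw.1 _ hmem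
    have hc := hz.first_le π hπ p hp.2
    cases b <;> simp at this <;> omega

theorem isJump_succ_iff (hz : IsZigzag n L' L c) (hπ : π ∈ L') {p d : ℕ} (hp : p ≤ n)
    {dir : Direction} {z : List ℕ} :
    IsJump (n + 1) dir d (π.insertIdx p (n + 1)) z ↔
      0 < d ∧ ∃ q ≤ n, z = π.insertIdx q (n + 1) ∧
        match dir with
        | .right => q = p + d
        | .left => p = q + d := by
  have := isJump_insertIdx_iff (d := d) (dir := dir) (z := z) (fun a => hz.lt_of_mem hπ)
    (hp.trans_eq (hz.length_eq hπ).symm)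
  rw [hz.length_eq hπ] at this
  cases dir <;> exact this

theorem not_isCandidate_of_lt (hz : IsZigzag n L' L c) (hπ : π ∈ L') {p v : ℕ} (hv : n + 1 < v)
    (hp : p ≤ n) (visited : List (List ℕ)) (dir : Direction) (z : List ℕ) :
    ¬ IsCandidate L visited (π.insertIdx p (n + 1)) v dir z := by
  rintro ⟨⟨d, hd, -⟩, -⟩
  rcases (List.mem_insertIdx (by rwa [hz.length_eq hπ])).1 hd.mem with h | h
  · omega
  · exact absurd (hz.lt_of_mem hπ h) (by omega)

/-- No value exceeds `n + 1`, so only its own jumps compete. The positions up to `p` in the block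
are visited, so unvisited ones lie on one side only, and consecutiveness of `p` and `p'` is
minimality of the jump. -/
theorem isStep_of_consecutive (hz : IsZigzag n L' L c) (hπ : π ∈ L') {B₁ B₂ : List ℕ}
    {p p' : ℕ} (h : orderedPositions L n b π = B₁ ++ p :: p' :: B₂) {visited : List (List ℕ)}
    (hvis : ∀ q ∈ B₁ ++ [p], π.insertIdx q (n + 1) ∈ visited)
    (hnew : π.insertIdx p' (n + 1) ∉ visited) :
    IsStep L visited (π.insertIdx p (n + 1)) (π.insertIdx p' (n + 1)) := by
  have hmem : ∀ q, q ≤ n ∧ π.insertIdx q (n + 1) ∈ L ↔ q ∈ B₁ ++ p :: p' :: B₂ := fun q => by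
    rw [← h, mem_orderedPositions]
  have hp := (hmem p).2 (by simp)
  have hp' := (hmem p').2 (by simp)
  have hpw := pairwise_orderedPositions (L := L) (n := n) b π
  rw [h, List.pairwise_append, List.pairwise_cons, List.pairwise_cons] at hpw
  obtain ⟨-, ⟨hpB, -⟩, -⟩ := hpw
  have hpp' := hpB p' (by simp)
  have hbetween := fun q hq => not_between_of_consecutive h (q := q) hq
  have hside : ∀ q ≤ n, π.insertIdx q (n + 1) ∈ L → π.insertIdx q (n + 1) ∉ visited →
      if b then q < p else p < q := by
    intro q hq hqL hqv
    have := (hmem q).1 ⟨hq, hqL⟩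
    rw [← List.singleton_append, ← List.append_assoc, List.mem_append] at this
    rcases this with hq | hq
    · exact absurd (hvis q hq) hqv
    · exact hpB q hq
  refine ⟨n + 1, if b then .left else .right, ⟨?_, hp'.2, hnew⟩,
    fun w hw dir z => hz.not_isCandidate_of_lt hπ hw hp.1 _ _ _, ?_⟩
  · refine ⟨if b then p - p' else p' - p, ?_, ?_⟩
    · rw [hz.isJump_succ_iff hπ hp.1]
      refine ⟨by cases b <;> simp at hpp' ⊢ <;> omega, p', hp'.1, rfl, ?_⟩
      cases b <;> simp at hpp' ⊢ <;> omega
    · intro d' hd' z hz'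
      rw [hz.isJump_succ_iff hπ hp.1] at hz'
      obtain ⟨hd0, q, hq, rfl, hz'⟩ := hz'
      intro hqL
      apply hbetween q hq hqL
      cases b <;> simp at hz' hd' ⊢ <;> omega
  · rintro dir hdir z ⟨⟨d, hd, -⟩, hzL, hzv⟩
    rw [hz.isJump_succ_iff hπ hp.1] at hd
    obtain ⟨hd0, q, hq, rfl, hd⟩ := hd
    have := hside q hq hzL hzv
    cases b <;> cases dir <;> simp at hdir hd this <;> omega

/-- At either end, `n + 1` neither takes part in nor blocks jumps of smaller values. Minimality
transfers because insertion at `e` maps members of `L'` to members of `L` and non-members to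
non-members. -/
theorem isCandidate_iff (hz : IsZigzag n L' L c) (hπ : π ∈ L') {e : ℕ} (he : e = 0 ∨ e = n)
    (hmem : ∀ π ∈ L', π.insertIdx e (n + 1) ∈ L) {visited visited' : List (List ℕ)}
    (hvis : ∀ π ∈ L', π.insertIdx e (n + 1) ∈ visited ↔ π ∈ visited') {v : ℕ} (hv : v < n + 1)
    {dir : Direction} {z : List ℕ} :
    IsCandidate L visited (π.insertIdx e (n + 1)) v dir z ↔
      ∃ π', z = π'.insertIdx e (n + 1) ∧ IsCandidate L' visited' π v dir π' := by
  have hen : e ≤ n := by omega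
  have hL : ∀ π', π'.Perm π → (π'.insertIdx e (n + 1) ∈ L ↔ π' ∈ L') := by
    refine fun π' hp => ⟨fun h => ?_, hmem π'⟩
    obtain ⟨ρ, hρ, q, hq, h⟩ := hz.exists_insertIdx _ h
    rw [(insertIdx_succ_inj (hz.succ_notMem hρ)
      (by rwa [hp.length_eq, hz.length_eq hπ]) (by rwa [hz.length_eq hρ]) h).1]
    exact hρ
  have hJ : ∀ d z, IsJump v dir d (π.insertIdx e (n + 1)) z ↔
      ∃ π', z = π'.insertIdx e (n + 1) ∧ IsJump v dir d π π' := fun d z =>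
    isJump_insertIdx_of_lt hv (hz.length_eq hπ) he
  constructor
  · rintro ⟨⟨d, hd, hmin⟩, hzL, hzv⟩
    obtain ⟨π', rfl, hd'⟩ := (hJ d z).1 hd
    have hπ' := (hL π' hd'.perm).1 hzL
    refine ⟨π', rfl, ⟨d, hd', fun d₁ hd₁ ρ hρ hρL => ?_⟩, hπ', fun h => hzv ((hvis _ hπ').2 h)⟩
    exact hmin d₁ hd₁ _ ((hJ d₁ _).2 ⟨ρ, rfl, hρ⟩) (hmem ρ hρL)
  · rintro ⟨π', rfl, ⟨d, hd, hmin⟩, hπ', hv'⟩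
    refine ⟨⟨d, (hJ d _).2 ⟨π', rfl, hd⟩, fun d₁ hd₁ ρ hρ hρL => ?_⟩, hmem _ hπ',
      fun h => hv' ((hvis _ hπ').1 h)⟩
    obtain ⟨ρ', rfl, hρ'⟩ := (hJ d₁ _).1 hρ
    exact hmin d₁ hd₁ ρ' hρ' ((hL ρ' hρ'.perm).1 hρL)

/-- By `hfull` the value `n + 1` has no candidate left, so the choice of value and direction takes
place among the jumps in `L'`. -/
theorem isStep_iff (hz : IsZigzag n L' L c) (hπ : π ∈ L') {e : ℕ} (he : e = 0 ∨ e = n)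
    (hmem : ∀ π ∈ L', π.insertIdx e (n + 1) ∈ L) {visited visited' : List (List ℕ)}
    (hvis : ∀ π ∈ L', π.insertIdx e (n + 1) ∈ visited ↔ π ∈ visited')
    (hfull : ∀ q ≤ n, π.insertIdx q (n + 1) ∈ L → π.insertIdx q (n + 1) ∈ visited)
    {z : List ℕ} :
    IsStep L visited (π.insertIdx e (n + 1)) z ↔
      ∃ π', z = π'.insertIdx e (n + 1) ∧ IsStep L' visited' π π' := by
  have hen : e ≤ n := by omega
  have hlarge : ∀ v ≥ n + 1, ∀ dir z,
      ¬ IsCandidate L visited (π.insertIdx e (n + 1)) v dir z := by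
    intro v hv dir z
    rcases hv.lt_or_eq with hv | rfl
    · exact hz.not_isCandidate_of_lt hπ hv hen _ _ _
    · rintro ⟨⟨d, hd, -⟩, hzL, hzv⟩
      rw [hz.isJump_succ_iff hπ hen] at hd
      obtain ⟨-, q, hq, rfl, -⟩ := hd
      exact hzv (hfull q hq hzL)
  have hlarge' : ∀ v ≥ n + 1, ∀ dir z, ¬ IsCandidate L' visited' π v dir z := by
    rintro v hv dir z ⟨⟨d, hd, -⟩, -⟩
    exact absurd (hz.lt_of_mem hπ hd.mem) (by omega)
  have hC : ∀ {v}, v < n + 1 → ∀ {dir z}, IsCandidate L visited (π.insertIdx e (n + 1)) v dir z ↔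
      ∃ π', z = π'.insertIdx e (n + 1) ∧ IsCandidate L' visited' π v dir π' := fun hv _ _ =>
    hz.isCandidate_iff hπ he hmem hvis hv
  constructor
  · rintro ⟨v, dir, hc, hw, hdir⟩
    have hv : v < n + 1 := by
      by_contra h
      exact hlarge v (by omega) _ _ hc
    obtain ⟨π', rfl, hc'⟩ := (hC hv).1 hc
    refine ⟨π', rfl, v, dir, hc', fun w hwv dir' ρ hρ => ?_, fun dir' hdir' ρ hρ => ?_⟩
    · by_cases hwn : w < n + 1
      · exact hw w hwv dir' _ ((hC hwn).2 ⟨ρ, rfl, hρ⟩)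
      · exact hlarge' w (by omega) _ _ hρ
    · exact hdir dir' hdir' _ ((hC hv).2 ⟨ρ, rfl, hρ⟩)
  · rintro ⟨π', rfl, v, dir, hc, hw, hdir⟩
    have hv : v < n + 1 := by
      by_contra h
      exact hlarge' v (by omega) _ _ hc
    refine ⟨v, dir, (hC hv).2 ⟨π', rfl, hc⟩, fun w hwv dir' ρ hρ => ?_,
      fun dir' hdir' ρ hρ => ?_⟩
    · by_cases hwn : w < n + 1
      · obtain ⟨ρ', rfl, hρ'⟩ := (hC hwn).1 hρ
        exact hw w hwv dir' _ hρ'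
      · exact hlarge w (by omega) _ _ hρ
    · obtain ⟨ρ', rfl, hρ'⟩ := (hC hv).1 hρ
      exact hdir dir' hdir' _ hρ'

/-- What the next member of a zigzag sequence can be. -/
theorem split_next (hz : IsZigzag n L' L c) {l : List (List ℕ)} (hl : ∀ π ∈ l, π ∈ L')
    {pre suf : List (List ℕ)} {x : List ℕ} (h : zigzag L n b l = pre ++ x :: suf) :
    (∃ l₁ π l₂ B₁ p p' B₂ b' suf', l = l₁ ++ π :: l₂ ∧
      orderedPositions L n b' π = B₁ ++ p :: p' :: B₂ ∧
      pre = zigzag L n b l₁ ++ B₁.map (fun p => π.insertIdx p (n + 1)) ∧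
      x = π.insertIdx p (n + 1) ∧ suf = π.insertIdx p' (n + 1) :: suf') ∨
    (∃ l₁ π l₂ e, l = l₁ ++ π :: l₂ ∧ (e = c ∨ e = n) ∧ x = π.insertIdx e (n + 1) ∧
      pre ++ [x] = zigzag L n b (l₁ ++ [π]) ∧
      (suf = [] ∧ l₂ = [] ∨
        ∃ π' l₃ suf', l₂ = π' :: l₃ ∧ suf = π'.insertIdx e (n + 1) :: suf')) := by
  obtain ⟨l₁, π, l₂, B₁, p, B₂, b', rfl, hB, rfl, rfl, h₃, rfl⟩ := zigzag_split h
  cases B₂ with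
  | cons p' B₂ => exact .inl ⟨l₁, π, l₂, B₁, p, p', B₂, b', _, rfl, hB, rfl, rfl, rfl⟩
  | nil =>
    refine .inr ⟨l₁, π, l₂, p, rfl, ?_, rfl, by simpa using h₃, ?_⟩
    · rw [hz.eq_endpoint_of_last (hl π (by simp)) hB]
      cases b' <;> simp
    · cases l₂ with
      | nil => exact .inl ⟨rfl, rfl⟩
      | cons π' l₃ =>
        have hπ' := hl π' (by simp)
        have hne := hz.endpoint_mem hπ' true (!b')
        cases hB' : orderedPositions L n (!b') π' with
        | nil => simp [hB'] at hne
        | cons p' B' =>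
          have hpp' := (hz.eq_endpoint_of_last (hl π (by simp)) hB).trans
            (hz.eq_endpoint_of_head hπ' hB').symm
          refine .inr ⟨π', l₃, B'.map (fun p => π'.insertIdx p (n + 1)) ++ zigzag L n (!!b') l₃,
            rfl, ?_⟩
          rw [zigzag, hB', ← hpp']
          rfl

/-- The first sweep is decreasing because the identity has `n + 1` in the last position. Inside a
block `isStep_of_consecutive` applies, and at the end of a block, including termination,
`isStep_iff` refers to the run on `L'`. -/
theorem isAlgorithmJOutput (hz : IsZigzag n L' L c) {l : List (List ℕ)}
    (hl : ∀ π, π ∈ l ↔ π ∈ L') (h : IsAlgorithmJOutput L' (idPerm n) l) :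
    IsAlgorithmJOutput L (idPerm (n + 1)) (zigzag L n true l) := by
  have hid : (idPerm n).insertIdx n (n + 1) = idPerm (n + 1) := by
    have := insertIdx_length_append (idPerm n) [] (n + 1)
    rw [List.append_nil, hz.length_eq h.1] at this
    rw [this, idPerm, idPerm, List.range'_concat]
    simp [add_comm]
  have hl' : ∀ π ∈ l, π ∈ L' := fun π => (hl π).1
  have hvis : ∀ l₁ π l₂ e, l = l₁ ++ π :: l₂ → (e = c ∨ e = n) →
      (e = 0 ∨ e = n) ∧ (∀ π ∈ L', π.insertIdx e (n + 1) ∈ L) ∧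
      (∀ π' ∈ L', π'.insertIdx e (n + 1) ∈ zigzag L n true (l₁ ++ [π]) ↔ π' ∈ l₁ ++ [π]) ∧
      (∀ q ≤ n, π.insertIdx q (n + 1) ∈ L →
        π.insertIdx q (n + 1) ∈ zigzag L n true (l₁ ++ [π])) := by
    intro l₁ π l₂ e hs he
    have hmem : ∀ π ∈ L', π.insertIdx e (n + 1) ∈ L := by
      rcases he with rfl | rfl
      · exact hz.first_mem
      · exact hz.last_mem
    have hen : e ≤ n := by
      rcases he with rfl | rfl
      · exact hz.le_last
      · exact le_rfl
    refine ⟨?_, hmem, fun π' hπ' => ?_, fun q hq hqL => ?_⟩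
    · have := hz.first_or_last
      omega
    · rw [mem_zigzag]
      constructor
      · rintro ⟨-, ρ, hρ, q, hq, hins⟩
        have hρl : ρ ∈ l := by
          rw [hs]
          simp only [List.mem_append, List.mem_cons, List.not_mem_nil, or_false] at hρ ⊢
          tauto
        rw [(hz.eq_of_insertIdx_eq hπ' (hl' ρ hρl) hen hq hins).1]
        exact hρ
      · exact fun h => ⟨hmem _ hπ', π', h, e, hen, rfl⟩
    · rw [mem_zigzag]
      exact ⟨hqL, π, by simp, q, hq, rfl⟩
  refine ⟨hid ▸ hz.last_mem _ h.1, ?_, ?_, ?_⟩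
  · obtain ⟨t, rfl⟩ : ∃ t, l = idPerm n :: t := by
      cases l with
      | nil => simpa using h.2.1
      | cons a t => exact ⟨t, by simpa using h.2.1⟩
    have hne := hz.endpoint_mem h.1 true true
    cases hB : orderedPositions L n true (idPerm n) with
    | nil => simp [hB] at hne
    | cons p B =>
      have := hz.eq_endpoint_of_head (b := false) h.1 hB
      simp only [Bool.false_eq_true, if_false] at this
      rw [zigzag, hB, this]
      simp [hid]
  · intro pre x x' suf hs
    rw [List.append_assoc] at hs
    rcases hz.split_next hl' hs with ⟨l₁, π, l₂, B₁, p, p', B₂, b', suf', hs', hB, rfl, rfl, hx'⟩ |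
      ⟨l₁, π, l₂, e, hs', he, rfl, hpre, hsuf⟩
    · obtain ⟨rfl, -⟩ : x' = _ ∧ _ := by simpa using hx'
      have hπ := hl' π (by simp [hs'])
      have hp' : p' ≤ n := (mem_orderedPositions.1 (hB ▸ (by simp : p' ∈ B₁ ++ p :: p' :: B₂))).1
      refine hz.isStep_of_consecutive hπ hB (fun q hq => ?_) ?_
      · simp only [List.mem_append, List.mem_singleton] at hq
        rcases hq with hq | rfl
        · simp only [List.mem_append, List.mem_map]
          exact .inl (.inr ⟨q, hq, rfl⟩)
        · simp
      -- The new entry is not in an earlier block, since `l` has no duplicates, and not earlier in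
      -- its own block, since positions are strictly monotone there.
      · intro hmem
        have hnd' : l.Nodup := h.nodup
        rw [List.append_assoc, List.mem_append, mem_zigzag] at hmem
        rcases hmem with ⟨-, ρ, hρ, q, hq, hins⟩ | hmem
        · obtain ⟨rfl, -⟩ := hz.eq_of_insertIdx_eq hπ (hl' ρ (by simp [hs', hρ])) hp' hq hins
          rw [hs'] at hnd'
          exact (List.nodup_middle.1 hnd').notMem (by simp [hρ])
        · obtain ⟨q, hq, hins⟩ : ∃ q ∈ B₁ ++ [p], π.insertIdx q (n + 1) = π.insertIdx p' (n + 1) := by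
            simpa [or_and_right, exists_or, eq_comm] using hmem
          have hq' : q ≤ n := (mem_orderedPositions.1 (hB ▸ (by
            rw [← List.singleton_append, ← List.append_assoc]
            exact List.mem_append_left _ hq : q ∈ B₁ ++ p :: p' :: B₂))).1
          obtain rfl := (hz.eq_of_insertIdx_eq hπ hπ hq' hp' hins).2
          have := pairwise_orderedPositions (L := L) (n := n) b' π
          rw [hB, ← List.singleton_append, ← List.append_assoc, List.pairwise_append] at this
          have := this.2.2 q hq q (by simp)
          cases b' <;> simp at this
    · have hπ := hl' π (by simp [hs'])
      obtain ⟨he', hmem, hv, hfull⟩ := hvis l₁ π l₂ e hs' he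
      rcases hsuf with ⟨hsuf, -⟩ | ⟨π', l₃, suf', rfl, hsuf⟩
      · simp at hsuf
      · obtain ⟨rfl, -⟩ : x' = _ ∧ _ := by simpa using hsuf
        rw [hpre, hz.isStep_iff hπ he' hmem hv hfull]
        exact ⟨π', rfl, h.2.2.1 l₁ π π' l₃ (by simp [hs'])⟩
  · intro pre x hs z hstep
    rcases hz.split_next hl' hs with ⟨l₁, π, l₂, B₁, p, p', B₂, b', suf', hs', hB, rfl, rfl, hx'⟩ |
      ⟨l₁, π, l₂, e, hs', he, rfl, hpre, hsuf⟩
    · simp at hx'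
    · have hπ := hl' π (by simp [hs'])
      obtain ⟨he', hmem, hv, hfull⟩ := hvis l₁ π l₂ e hs' he
      rcases hsuf with ⟨-, rfl⟩ | ⟨π', l₃, suf', rfl, hsuf⟩
      · rw [hs, hpre, hz.isStep_iff hπ he' hmem hv hfull] at hstep
        obtain ⟨π', -, hstep⟩ := hstep
        rw [← hs'] at hstep
        exact h.2.2.2 l₁ π hs' π' hstep
      · simp at hsuf

/-- Relations between neighbours in a zigzag sequence. -/
theorem isChain_zigzag (hz : IsZigzag n L' L c) {l : List (List ℕ)} (hl : ∀ π ∈ l, π ∈ L')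
    {R R' : List ℕ → List ℕ → Prop} (hsymm : ∀ x y, R x y → R y x) (hR' : l.IsChain R')
    (hR : ∀ π ∈ L', ∀ p q, p < q → q ≤ n → π.insertIdx p (n + 1) ∈ L → π.insertIdx q (n + 1) ∈ L →
      (∀ r, p < r → r < q → π.insertIdx r (n + 1) ∉ L) →
      R (π.insertIdx p (n + 1)) (π.insertIdx q (n + 1)))
    (hfirst : ∀ π ∈ L', ∀ π' ∈ L', R' π π' → R (π.insertIdx c (n + 1)) (π'.insertIdx c (n + 1)))
    (hlast : ∀ π ∈ L', ∀ π' ∈ L', R' π π' → R (π.insertIdx n (n + 1)) (π'.insertIdx n (n + 1))) :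
    (zigzag L n b l).IsChain R := by
  rw [List.isChain_iff_forall_rel_of_append_cons_cons] at hR' ⊢
  intro x x' pre suf hs
  rcases hz.split_next hl hs with ⟨l₁, π, l₂, B₁, p, p', B₂, b', suf', rfl, hB, -, rfl, hx'⟩ |
    ⟨l₁, π, l₂, e, rfl, he, rfl, -, hsuf⟩
  · obtain ⟨rfl, -⟩ : x' = _ ∧ _ := by simpa using hx'
    have hπ := hl π (by simp)
    have hp := mem_orderedPositions.1 (hB ▸ (by simp : p ∈ B₁ ++ p :: p' :: B₂))
    have hp' := mem_orderedPositions.1 (hB ▸ (by simp : p' ∈ B₁ ++ p :: p' :: B₂))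
    have hpw := pairwise_orderedPositions (L := L) (n := n) b' π
    rw [hB, List.pairwise_append, List.pairwise_cons] at hpw
    have hpp' := hpw.2.1.1 p' (by simp)
    cases b'
    · refine hR π hπ p p' hpp' hp'.1 hp.2 hp'.2 fun r h₁ h₂ hr => ?_
      exact not_between_of_consecutive hB (by omega) hr ⟨h₁, h₂⟩
    · refine hsymm _ _ (hR π hπ p' p hpp' hp.1 hp'.2 hp.2 fun r h₁ h₂ hr => ?_)
      exact not_between_of_consecutive hB (by omega) hr ⟨h₁, h₂⟩
  · rcases hsuf with ⟨hsuf, -⟩ | ⟨π', l₃, suf', rfl, hsuf⟩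
    · simp at hsuf
    · obtain ⟨rfl, -⟩ : x' = _ ∧ _ := by simpa using hsuf
      have hππ' := hR' rfl
      rcases he with rfl | rfl
      · exact hfirst π (hl π (by simp)) π' (hl π' (by simp)) hππ'
      · exact hlast π (hl π (by simp)) π' (hl π' (by simp)) hππ'

end IsZigzag

/-! ### Orientations compatible with a linear order -/

/-- Every hyperedge has its head at the vertex that comes last in the list `l`. -/
def Compatible {H : Hypergraph ℕ} (l : List ℕ) (h : Orientation H) : Prop :=
  ∀ A : H.edgeSet, ∀ a ∈ A.1, l.idxOf a ≤ l.idxOf (h A : ℕ)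

section Compatible

variable {H : Hypergraph ℕ} {l : List ℕ}

theorem mem_vertexSet (A : H.edgeSet) {a : ℕ} (ha : a ∈ A.1) : a ∈ H.vertexSet :=
  H.subset_vertexSet_of_mem_edgeSet' A.2 ha

theorem Arc.of_mem (h : Orientation H) {A : H.edgeSet} {a : ℕ} (ha : a ∈ A.1)
    (hne : a ≠ (h A : ℕ)) : Arc h a (h A) :=
  ⟨hne, A, ha, rfl⟩

theorem Compatible.eq (hl : ∀ a ∈ H.vertexSet, a ∈ l) {h h' : Orientation H}
    (hh : Compatible l h) (hh' : Compatible l h') : h = h' := by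
  funext A
  exact Subtype.ext ((List.idxOf_inj (hl _ (mem_vertexSet A (h A).2))).1
    (le_antisymm (hh' A _ (h A).2) (hh A _ (h' A).2)))

theorem Compatible.lt_of_prec (hl : ∀ a ∈ H.vertexSet, a ∈ l) {h : Orientation H}
    (hh : Compatible l h) {i j : ℕ} (hij : Prec h i j) : l.idxOf i < l.idxOf j := by
  have key : ∀ {i j}, Arc h i j → l.idxOf i < l.idxOf j := by
    rintro i j ⟨hne, A, hi, rfl⟩
    exact lt_of_le_of_ne (hh A i hi) fun e =>
      hne ((List.idxOf_inj (hl _ (mem_vertexSet A hi))).1 e)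
  induction hij with
  | single h => exact key h
  | tail _ h ih => exact ih.trans (key h)

theorem Compatible.isAcyclic (hl : ∀ a ∈ H.vertexSet, a ∈ l) {h : Orientation H}
    (hh : Compatible l h) : IsAcyclic h :=
  fun _ hi => lt_irrefl _ (hh.lt_of_prec hl hi)

theorem exists_compatible (hfin : H.vertexSet.Finite) (hne : ∀ A ∈ H.edgeSet, A.Nonempty)
    (l : List ℕ) : ∃ h : Orientation H, Compatible l h := by
  have : ∀ A : H.edgeSet, ∃ x : A.1, ∀ a ∈ A.1, l.idxOf a ≤ l.idxOf x.1 := fun A => by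
    obtain ⟨x, hx, hmax⟩ := Set.exists_max_image A.1 l.idxOf
      (hfin.subset (H.subset_vertexSet_of_mem_edgeSet' A.2)) (hne A A.2)
    exact ⟨⟨x, hx⟩, hmax⟩
  choose h hh using this
  exact ⟨h, hh⟩

theorem idxOf_insertIdx_self {v p : ℕ} (hv : v ∉ l) (hp : p ≤ l.length) :
    (l.insertIdx p v).idxOf v = p := by
  rw [insertIdx_eq_take_drop hp, List.idxOf_append_of_notMem
    (fun h => hv (List.mem_of_mem_take h))]
  simp [hp]

theorem idxOf_insertIdx_of_ne {v p a : ℕ} (hne : a ≠ v) (hp : p ≤ l.length) :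
    (l.insertIdx p v).idxOf a = if l.idxOf a < p then l.idxOf a else l.idxOf a + 1 := by
  induction l generalizing p with
  | nil =>
    obtain rfl : p = 0 := by simpa using hp
    simp [hne.symm]
  | cons b l ih =>
    cases p with
    | zero => simp [List.idxOf_cons_ne _ hne.symm]
    | succ p =>
      rw [List.insertIdx_succ_cons]
      by_cases hb : b = a
      · subst hb; simp
      · rw [List.idxOf_cons_ne _ hb, List.idxOf_cons_ne _ hb, ih (by simpa using hp)]
        split_ifs <;> grind

/-- Expresses compatibility by positions in `l` alone, so that insertions at different `p` can be
compared through one index function. -/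
theorem compatible_insertIdx_iff {v p : ℕ} (hv : v ∉ l) (hp : p ≤ l.length)
    {h : Orientation H} :
    Compatible (l.insertIdx p v) h ↔ ∀ A : H.edgeSet,
      ((h A : ℕ) = v → ∀ a ∈ A.1, a ≠ v → l.idxOf a < p) ∧
      ((h A : ℕ) ≠ v → (v ∈ A.1 → p ≤ l.idxOf (h A : ℕ)) ∧
        ∀ a ∈ A.1, a ≠ v → l.idxOf a ≤ l.idxOf (h A : ℕ)) := by
  refine forall_congr' fun A => ?_
  by_cases hA : (h A : ℕ) = v
  · simp only [hA, idxOf_insertIdx_self hv hp, ne_eq, not_true_eq_false, false_implies, and_true,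
      forall_const]
    refine forall₂_congr fun a ha => ?_
    by_cases hav : a = v
    · simp [hav, idxOf_insertIdx_self hv hp]
    · rw [idxOf_insertIdx_of_ne hav hp]
      split_ifs <;> grind
  · simp only [hA, ne_eq, not_false_eq_true, false_implies, true_and, forall_const]
    constructor
    · refine fun H => ⟨fun hvA => ?_, fun a ha hav => ?_⟩
      · have := H v hvA
        rw [idxOf_insertIdx_self hv hp, idxOf_insertIdx_of_ne hA hp] at this
        split_ifs at this <;> omega
      · have := H a ha
        rw [idxOf_insertIdx_of_ne hav hp, idxOf_insertIdx_of_ne hA hp] at this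
        split_ifs at this <;> omega
    · rintro ⟨h₁, h₂⟩ a ha
      rw [idxOf_insertIdx_of_ne hA hp]
      by_cases hav : a = v
      · subst hav
        have := h₁ ha
        rw [idxOf_insertIdx_self hv hp]
        split_ifs <;> omega
      · have := h₂ a ha hav
        rw [idxOf_insertIdx_of_ne hav hp]
        split_ifs <;> omega

end Compatible

/-! ### The encoding -/

/-- The first condition of a hyperfect elimination order, for the vertex `v`. -/
def IsHyperfect (H : Hypergraph ℕ) (v : ℕ) : Prop :=
  ∀ A ∈ H.edgeSet, ∀ B ∈ H.edgeSet, v ∈ A ∩ B →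
    ∀ a ∈ A \ {v}, ∀ b ∈ B \ {v}, a ≠ b →
      ∃ X ∈ H.edgeSet, {a, b} ⊆ X ∧ X ⊆ (A ∪ B) \ {v}

section Encode

variable {H : Hypergraph ℕ}

theorem Arc.not_symm {h : Orientation H} (hh : IsAcyclic h) {i j : ℕ} (hij : Arc h i j) :
    ¬ Arc h j i :=
  fun hji => hh i (Relation.TransGen.tail (.single hij) hji)

/-- If the head of `X` lies in `A`, it must be the head of `A`: otherwise `A` and `X` give opposite
arcs between the two heads. For `A = B` the second alternative is void, and `X` has the head of `A`.
-/
theorem IsHyperfect.exists_edge {v : ℕ} (hH : IsHyperfect H v) {h : Orientation H}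
    (hh : IsAcyclic h) {A B : H.edgeSet} (hvA : v ∈ A.1) (hvB : v ∈ B.1) (hA : (h A : ℕ) ≠ v)
    {a : ℕ} (ha : a ∈ B.1) (hav : a ≠ v) (hne : a ≠ (h A : ℕ)) :
    ∃ X : H.edgeSet, a ∈ X.1 ∧ (h A : ℕ) ∈ X.1 ∧ v ∉ X.1 ∧ X.1 ⊆ A.1 ∪ B.1 ∧
      ((h X : ℕ) = h A ∨ (h X : ℕ) ∈ B.1 ∧ (h X : ℕ) ∉ A.1) := by
  obtain ⟨X, hX, hsub, hsup⟩ := hH A A.2 B B.2 ⟨hvA, hvB⟩ (h A) ⟨(h A).2, hA⟩ a ⟨ha, hav⟩ hne.symm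
  refine ⟨⟨X, hX⟩, hsub (by simp), hsub (by simp), fun hv => (hsup hv).2 rfl,
    hsup.trans Set.sdiff_subset, ?_⟩
  by_cases hXA : (h ⟨X, hX⟩ : ℕ) ∈ A.1
  · left
    by_contra hXne
    exact (Arc.of_mem h hXA hXne).not_symm hh
      (Arc.of_mem h (A := ⟨X, hX⟩) (hsub (by simp)) (Ne.symm hXne))
  · exact .inr ⟨(hsup (h ⟨X, hX⟩).2).1.resolve_left hXA, hXA⟩

theorem vertexSet_restrict {n : ℕ} (hV : H.vertexSet = Set.Icc 1 (n + 1)) :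
    (restrict H n).vertexSet = Set.Icc 1 n := by
  simp only [restrict, hV]
  exact Set.inter_eq_self_of_subset_right (Set.Icc_subset_Icc_right (by omega))

theorem subset_Icc_of_succ_notMem {n : ℕ} (hV : H.vertexSet = Set.Icc 1 (n + 1)) (A : H.edgeSet)
    (hA : n + 1 ∉ A.1) : A.1 ⊆ Set.Icc 1 n := by
  intro a ha
  have h := mem_vertexSet A ha
  rw [hV] at h
  have : a ≠ n + 1 := fun e => hA (e ▸ ha)
  exact ⟨h.1, by have := h.2; omega⟩

theorem length_encode (n : ℕ) (h : AO H) : (encode n h).length = n := by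
  simpa using (encode_perm n h).length_eq

theorem mem_encode {n : ℕ} {h : AO H} {a : ℕ} : a ∈ encode n h ↔ a ∈ Set.Icc 1 n := by
  rw [(encode_perm n h).mem_iff, List.mem_range'_1, Set.mem_Icc]
  omega

theorem succ_notMem_encode {n : ℕ} {H' : Hypergraph ℕ} (h : AO H') : n + 1 ∉ encode n h := by
  simp [mem_encode]

/-- Compatibility of the restriction with its encoding, in terms of `H`. -/
theorem idxOf_le_of_restrict {n : ℕ} (hV : H.vertexSet = Set.Icc 1 (n + 1)) {h : AO H}
    {l : List ℕ} (hg : Compatible l (h.restrict n).1) (A : H.edgeSet) (hA : n + 1 ∉ A.1) {a : ℕ}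
    (ha : a ∈ A.1) : l.idxOf a ≤ l.idxOf (h.1 A : ℕ) :=
  hg ⟨A.1, A.2, subset_Icc_of_succ_notMem hV A hA⟩ a ha

/-- If `A` contains `n + 1` but has another head, then `a` and this head lie in some `X ⊆ A \ {n +
1}` with the same head, so the restriction already orders them. -/
theorem IsHyperfect.idxOf_le {n : ℕ} (hV : H.vertexSet = Set.Icc 1 (n + 1))
    (hH : IsHyperfect H (n + 1)) {h : AO H} {l : List ℕ}
    (hg : Compatible l (h.restrict n).1) (A : H.edgeSet) (hA : (h.1 A : ℕ) ≠ n + 1)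
    {a : ℕ} (ha : a ∈ A.1) (han : a ≠ n + 1) : l.idxOf a ≤ l.idxOf (h.1 A : ℕ) := by
  by_cases hnA : n + 1 ∈ A.1
  · by_cases hne : a = (h.1 A : ℕ)
    · rw [← hne]
    · obtain ⟨X, haX, -, hnX, -, hX | hX⟩ := hH.exists_edge h.2 hnA hnA hA ha han hne
      · rw [← hX]
        exact idxOf_le_of_restrict hV hg X hnX haX
      · exact absurd hX.1 hX.2
  · exact idxOf_le_of_restrict hV hg A hnA ha

/-- In the case that is neither maximal nor minimal, the cover of `n + 1` is the earliest vertex in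
`l` among the heads different from `n + 1` of hyperedges through `n + 1`. Hyperfectness puts
everything with an arc into `n + 1` before this vertex. -/
theorem exists_encode_succ {n : ℕ} (hV : H.vertexSet = Set.Icc 1 (n + 1))
    (hH : IsHyperfect H (n + 1)) (h : AO H)
    (hg : Compatible (encode n (h.restrict n)) (h.restrict n).1) :
    ∃ p ≤ n, encode (n + 1) h = (encode n (h.restrict n)).insertIdx p (n + 1) ∧
      Compatible ((encode n (h.restrict n)).insertIdx p (n + 1)) h.1 ∧
      ((¬ ∃ j, Prec h.1 (n + 1) j) → p = n) ∧
      ((∃ j, Prec h.1 (n + 1) j) → (¬ ∃ j, Prec h.1 j (n + 1)) → p = 0) := by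
  set l := encode n (h.restrict n) with hl
  have hlen : l.length = n := length_encode n _
  have hnl : n + 1 ∉ l := succ_notMem_encode _
  have hle : ∀ A : H.edgeSet, (h.1 A : ℕ) ≠ n + 1 → ∀ a ∈ A.1, a ≠ n + 1 →
      l.idxOf a ≤ l.idxOf (h.1 A : ℕ) := fun A hA a ha han =>
    hH.idxOf_le hV hg A hA ha han
  have hmem : ∀ A : H.edgeSet, ∀ a ∈ A.1, a ≠ n + 1 → a ∈ l := fun A a ha han => by
    have := mem_vertexSet A ha
    rw [hV, Set.mem_Icc] at this
    exact mem_encode.2 ⟨this.1, by omega⟩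
  have hmem' : ∀ p ≤ n, ∀ a ∈ H.vertexSet, a ∈ l.insertIdx p (n + 1) := fun p hp a ha => by
    rw [List.mem_insertIdx (by rwa [hlen]), hl, mem_encode, Set.mem_Icc]
    rw [hV, Set.mem_Icc] at ha
    omega
  by_cases hmax : ∃ j, Prec h.1 (n + 1) j
  · by_cases hmin : ∃ j, Prec h.1 j (n + 1)
    · obtain ⟨A₀, hA₀, hA₀n⟩ : ∃ A : H.edgeSet, n + 1 ∈ A.1 ∧ (h.1 A : ℕ) ≠ n + 1 := by
        obtain ⟨j, hj⟩ := hmax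
        obtain ⟨k, ⟨hne, A, hA, rfl⟩, -⟩ := Relation.TransGen.head'_iff.1 hj
        exact ⟨A, hA, hne.symm⟩
      obtain ⟨A, ⟨hnA, hAn⟩, hAmin⟩ : ∃ A : H.edgeSet, (n + 1 ∈ A.1 ∧ (h.1 A : ℕ) ≠ n + 1) ∧
          ∀ B : H.edgeSet, n + 1 ∈ B.1 ∧ (h.1 B : ℕ) ≠ n + 1 →
            l.idxOf (h.1 A : ℕ) ≤ l.idxOf (h.1 B : ℕ) := by
        have hne : {B : H.edgeSet | n + 1 ∈ B.1 ∧ (h.1 B : ℕ) ≠ n + 1}.Nonempty :=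
          ⟨A₀, hA₀, hA₀n⟩
        refine ⟨Function.argminOn (fun B => l.idxOf (h.1 B : ℕ)) _ hne,
          Function.argminOn_mem _ _ hne, fun B hB => Function.argminOn_le (fun B => l.idxOf (h.1 B : ℕ))
            {B : H.edgeSet | n + 1 ∈ B.1 ∧ (h.1 B : ℕ) ≠ n + 1} hB⟩
      have hpn : l.idxOf (h.1 A : ℕ) ≤ n := hlen ▸ List.idxOf_le_length
      have harc : Arc h.1 (n + 1) (h.1 A) := Arc.of_mem h.1 hnA hAn.symm
      have hcompat : Compatible (l.insertIdx (l.idxOf (h.1 A : ℕ)) (n + 1)) h.1 := by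
        rw [compatible_insertIdx_iff hnl (hlen.symm ▸ hpn)]
        refine fun B => ⟨fun hB a ha han => ?_, fun hB => ⟨fun hnB => hAmin B ⟨hnB, hB⟩, hle B hB⟩⟩
        have hnB : n + 1 ∈ B.1 := hB ▸ (h.1 B).2
        have haB : Arc h.1 a (n + 1) := ⟨han, B, ha, hB⟩
        by_cases hne : a = (h.1 A : ℕ)
        · rw [hne] at haB
          exact absurd haB (harc.not_symm h.2)
        · obtain ⟨X, haX, hAX, hnX, -, hX | ⟨hXB, hXA⟩⟩ := hH.exists_edge h.2 hnA hnB hAn ha han hne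
          · refine lt_of_le_of_ne (hX ▸ idxOf_le_of_restrict hV hg X hnX haX) fun e => hne ?_
            exact (List.idxOf_inj (hmem B a ha han)).1 e
          -- The alternative is impossible because of the cycle from the head of `X` to `n + 1`, to
          -- the head of `A`, and back to the head of `X`.
          · have h₁ : Arc h.1 (h.1 X) (n + 1) := ⟨fun e => hnX (e ▸ (h.1 X).2), B, hXB, hB⟩
            have h₂ : Arc h.1 (h.1 A) (h.1 X) := Arc.of_mem h.1 hAX fun e => hXA (e ▸ (h.1 A).2)
            exact absurd (((Relation.TransGen.single h₁).tail harc).tail h₂) (h.2 _)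
      have hlow : ∀ k, Prec h.1 (n + 1) k → ∃ B : H.edgeSet, n + 1 ∈ B.1 ∧ (h.1 B : ℕ) ≠ n + 1 ∧
          Relation.ReflTransGen (Arc h.1) (h.1 B) k := by
        intro k hk
        obtain ⟨j, ⟨hne, B, hB, rfl⟩, hjk⟩ := Relation.TransGen.head'_iff.1 hk
        exact ⟨B, hB, hne.symm, hjk⟩
      have hidx : ∀ a b, a ≠ n + 1 → b ≠ n + 1 → Prec h.1 a b → l.idxOf a < l.idxOf b := by
        intro a b ha hb hab
        have := hcompat.lt_of_prec (hmem' _ hpn) hab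
        rw [idxOf_insertIdx_of_ne ha (hlen.symm ▸ hpn), idxOf_insertIdx_of_ne hb (hlen.symm ▸ hpn)]
          at this
        split_ifs at this <;> omega
      have hcov : Covers h.1 (h.1 A) (n + 1) := by
        refine ⟨.single harc, fun ⟨k, hk, hkA⟩ => ?_⟩
        obtain ⟨B, hnB, hBn, hBk⟩ := hlow k hk
        exact absurd (hidx _ _ hBn hAn (Relation.TransGen.trans_right hBk hkA))
          (not_lt.2 (hAmin B ⟨hnB, hBn⟩))
      have huniq : ∀ b, Covers h.1 b (n + 1) → b = h.1 A := by
        rintro b ⟨hb, hnob⟩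
        obtain ⟨B, hnB, hBn, hBb⟩ := hlow b hb
        obtain rfl : b = h.1 B := by
          by_contra hne
          rcases Relation.reflTransGen_iff_eq_or_transGen.1 hBb with e | hBb
          · exact hne e
          · exact hnob ⟨h.1 B, .single (Arc.of_mem h.1 hnB hBn.symm), hBb⟩
        by_contra hne
        -- A second cover, the head of `B`, shares `X` with the head of `A`. Either it precedes the
        -- head of `A`, against the choice of `A`, or the head of `A` lies strictly between `n + 1`
        -- and it.
        obtain ⟨X, hBX, hAX, hnX, -, hX | ⟨hXB, hXA⟩⟩ :=
          hH.exists_edge h.2 hnA hnB hAn (h.1 B).2 hBn hne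
        · exact absurd (hidx _ _ hBn hAn (.single (hX ▸ Arc.of_mem h.1 hBX (hX ▸ hne))))
            (not_lt.2 (hAmin B ⟨hnB, hBn⟩))
        · have hXe : (h.1 X : ℕ) = h.1 B := by
            by_contra hXe
            exact (Arc.of_mem h.1 hXB hXe).not_symm h.2 (Arc.of_mem h.1 hBX (Ne.symm hXe))
          exact hnob ⟨h.1 A, .single harc, .single (hXe ▸ Arc.of_mem h.1 hAX (hXe ▸ Ne.symm hne))⟩
      have heps : (Classical.epsilon fun b => Covers h.1 b (n + 1)) = (h.1 A : ℕ) :=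
        huniq _ (Classical.epsilon_spec (p := fun b => Covers h.1 b (n + 1)) ⟨_, hcov⟩)
      refine ⟨_, hpn, ?_, hcompat, fun h => absurd hmax h, fun _ h => absurd hmin h⟩
      rw [encode, if_neg (not_not.2 hmax), if_neg (not_not.2 hmin), heps]
    · refine ⟨0, by omega, ?_, ?_, fun h => absurd hmax h, fun _ _ => rfl⟩
      · rw [encode, if_neg (not_not.2 hmax), if_pos hmin, List.insertIdx_zero]
      · rw [compatible_insertIdx_iff hnl (by omega)]
        refine fun B => ⟨fun hB a ha han => ?_, fun hB => ⟨fun _ => Nat.zero_le _, hle B hB⟩⟩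
        exact absurd ⟨a, .single ⟨han, B, ha, hB⟩⟩ hmin
  · refine ⟨n, le_rfl, ?_, ?_, fun _ => rfl, fun h => absurd h hmax⟩
    · rw [encode, if_pos hmax, ← List.insertIdx_length_self, length_encode]
    · rw [compatible_insertIdx_iff hnl (by omega)]
      refine fun B => ⟨fun hB a ha han => ?_, fun hB => ⟨fun hnB => ?_, hle B hB⟩⟩
      · rw [← hlen]
        exact List.idxOf_lt_length_iff.2 (hmem B a ha han)
      · exact absurd ⟨_, .single (Arc.of_mem h.1 hnB hB.symm)⟩ hmax

theorem IsHEO.isHyperfect {n : ℕ} (hH : IsHEO (n + 1) H) : IsHyperfect H (n + 1) := hH.1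

theorem compatible_encode {n : ℕ} (hV : H.vertexSet = Set.Icc 1 n) (hH : IsHEO n H) (h : AO H) :
    Compatible (encode n h) h.1 := by
  induction n generalizing H with
  | zero => exact fun A a ha => by simp [encode]
  | succ n ih =>
    obtain ⟨p, -, he, hc, -⟩ := exists_encode_succ hV hH.1 h
      (ih (vertexSet_restrict hV) hH.2 (h.restrict n))
    rwa [he]

theorem encode_injective {n : ℕ} (hV : H.vertexSet = Set.Icc 1 n) (hH : IsHEO n H) :
    Function.Injective fun h : AO H => encode n h := by
  intro h h' e
  have hc := compatible_encode hV hH h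
  rw [show encode n h = encode n h' from e] at hc
  exact Subtype.ext (hc.eq (fun a ha => mem_encode.2 (hV ▸ ha)) (compatible_encode hV hH h'))

end Encode

/-! ### The encodings form a zigzag language -/

section Fiber

variable {n : ℕ} {H : Hypergraph ℕ}

theorem compatible_encode_insertIdx_iff {p : ℕ} (hp : p ≤ n) {g : AO (restrict H n)}
    {h : Orientation H} :
    Compatible ((encode n g).insertIdx p (n + 1)) h ↔ ∀ A : H.edgeSet,
      ((h A : ℕ) = n + 1 → ∀ a ∈ A.1, a ≠ n + 1 → (encode n g).idxOf a < p) ∧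
      ((h A : ℕ) ≠ n + 1 → (n + 1 ∈ A.1 → p ≤ (encode n g).idxOf (h A : ℕ)) ∧
        ∀ a ∈ A.1, a ≠ n + 1 → (encode n g).idxOf a ≤ (encode n g).idxOf (h A : ℕ)) :=
  compatible_insertIdx_iff (succ_notMem_encode g) (by rwa [length_encode])

theorem mem_encode_of_mem (hV : H.vertexSet = Set.Icc 1 (n + 1)) (g : AO (restrict H n))
    (A : H.edgeSet) {a : ℕ} (ha : a ∈ A.1) (han : a ≠ n + 1) : a ∈ encode n g := by
  have := mem_vertexSet A ha
  rw [hV, Set.mem_Icc] at this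
  exact mem_encode.2 ⟨this.1, by omega⟩

theorem idxOf_encode_lt (hV : H.vertexSet = Set.Icc 1 (n + 1)) (g : AO (restrict H n))
    (A : H.edgeSet) {a : ℕ} (ha : a ∈ A.1) (han : a ≠ n + 1) : (encode n g).idxOf a < n := by
  have := List.idxOf_lt_length_iff.2 (mem_encode_of_mem hV g A ha han)
  rwa [length_encode] at this

theorem eq_of_idxOf_encode_eq (hV : H.vertexSet = Set.Icc 1 (n + 1)) {g : AO (restrict H n)}
    {A : H.edgeSet} {a b : ℕ} (ha : a ∈ A.1) (han : a ≠ n + 1)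
    (h : (encode n g).idxOf a = (encode n g).idxOf b) : a = b :=
  (List.idxOf_inj (mem_encode_of_mem hV g A ha han)).1 h

theorem encode_succ_spec (hV : H.vertexSet = Set.Icc 1 (n + 1)) (hH : IsHEO (n + 1) H) (h : AO H) :
    ∃ p ≤ n, encode (n + 1) h = (encode n (h.restrict n)).insertIdx p (n + 1) ∧
      Compatible ((encode n (h.restrict n)).insertIdx p (n + 1)) h.1 ∧
      ((¬ ∃ j, Prec h.1 (n + 1) j) → p = n) ∧
      ((∃ j, Prec h.1 (n + 1) j) → (¬ ∃ j, Prec h.1 j (n + 1)) → p = 0) :=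
  exists_encode_succ hV hH.1 h (compatible_encode (vertexSet_restrict hV) hH.2 _)

/-- An acyclic orientation of the restriction can be extended such that the extension is compatible
with the insertion of the largest vertex at a given position. -/
theorem exists_extension (hV : H.vertexSet = Set.Icc 1 (n + 1))
    (hne : ∀ A ∈ H.edgeSet, A.Nonempty) (hH : IsHEO (n + 1) H) (g : AO (restrict H n)) {p : ℕ}
    (hp : p ≤ n) :
    ∃ h : AO H, h.restrict n = g ∧ Compatible ((encode n g).insertIdx p (n + 1)) h.1 := by
  have hfin : H.vertexSet.Finite := hV ▸ Set.finite_Icc 1 (n + 1)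
  obtain ⟨h, hh⟩ := exists_compatible hfin hne ((encode n g).insertIdx p (n + 1))
  have hac : IsAcyclic h := hh.isAcyclic fun a ha => by
    rw [List.mem_insertIdx (by rwa [length_encode]), mem_encode, Set.mem_Icc]
    rw [hV, Set.mem_Icc] at ha
    omega
  refine ⟨⟨h, hac⟩, Subtype.ext ?_, hh⟩
  refine Compatible.eq (l := encode n g) (fun a ha => mem_encode.2 (vertexSet_restrict hV ▸ ha)) ?_
    (compatible_encode (vertexSet_restrict hV) hH.2 g)
  intro A a ha
  rw [compatible_encode_insertIdx_iff hp] at hh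
  have hA : ∀ x ∈ A.1, x ≠ n + 1 := fun x hx e => by
    have := (A.2.2 hx).2
    omega
  exact ((hh ⟨A.1, A.2.1⟩).2 (hA _ (h ⟨A.1, A.2.1⟩).2)).2 a ha (hA a ha)

theorem exists_extension_last (hV : H.vertexSet = Set.Icc 1 (n + 1))
    (hne : ∀ A ∈ H.edgeSet, A.Nonempty) (hH : IsHEO (n + 1) H) (g : AO (restrict H n)) :
    ∃ h : AO H, h.restrict n = g ∧ encode (n + 1) h = (encode n g).insertIdx n (n + 1) := by
  obtain ⟨h, rfl, hc⟩ := exists_extension hV hne hH g le_rfl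
  obtain ⟨p, -, he, -, hmax, -⟩ := encode_succ_spec hV hH h
  refine ⟨h, rfl, ?_⟩
  rw [he, hmax]
  rintro ⟨j, hj⟩
  obtain ⟨k, ⟨hne, A, hA, rfl⟩, -⟩ := Relation.TransGen.head'_iff.1 hj
  rw [compatible_encode_insertIdx_iff le_rfl] at hc
  exact absurd (((hc A).2 hne.symm).1 hA) (not_le.2 (idxOf_encode_lt hV _ A (h.1 A).2 hne.symm))

/-- The encoding tests maximality before minimality, so `hA` is needed: it ensures that `n + 1`,
placed first, is not maximal. -/
theorem exists_extension_first (hV : H.vertexSet = Set.Icc 1 (n + 1))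
    (hne : ∀ A ∈ H.edgeSet, A.Nonempty) (hH : IsHEO (n + 1) H)
    (hA : ∃ A : H.edgeSet, n + 1 ∈ A.1 ∧ ∃ a ∈ A.1, a ≠ n + 1) (g : AO (restrict H n)) :
    ∃ h : AO H, h.restrict n = g ∧ encode (n + 1) h = (encode n g).insertIdx 0 (n + 1) := by
  obtain ⟨h, rfl, hc⟩ := exists_extension hV hne hH g (Nat.zero_le n)
  obtain ⟨p, -, he, -, -, hmin⟩ := encode_succ_spec hV hH h
  refine ⟨h, rfl, ?_⟩
  rw [compatible_encode_insertIdx_iff (Nat.zero_le n)] at hc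
  rw [he, hmin]
  · obtain ⟨A, hnA, a, ha, han⟩ := hA
    refine ⟨_, .single (Arc.of_mem h.1 hnA fun e => ?_)⟩
    exact absurd ((hc A).1 e.symm a ha han) (Nat.not_lt_zero _)
  · rintro ⟨j, hj⟩
    obtain ⟨k, -, ⟨hne, A, hA, hk⟩⟩ := Relation.TransGen.tail'_iff.1 hj
    exact absurd ((hc A).1 hk k hA hne) (Nat.not_lt_zero _)

/-- If `n + 1` shares a hyperedge with another vertex, the first position is always available and `c
= 0`. Otherwise `n + 1` is maximal in every orientation, so only the last position occurs and `c =
n`. -/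
theorem exists_isZigzag (hV : H.vertexSet = Set.Icc 1 (n + 1))
    (hne : ∀ A ∈ H.edgeSet, A.Nonempty) (hH : IsHEO (n + 1) H) :
    ∃ c, IsZigzag n (encodings n (restrict H n)) (encodings (n + 1) H) c := by
  have hperm : ∀ π ∈ encodings n (restrict H n), π.Perm (List.range' 1 n) := by
    rintro _ ⟨g, rfl⟩
    exact encode_perm n g
  have hins : ∀ x ∈ encodings (n + 1) H, ∃ π ∈ encodings n (restrict H n), ∃ p ≤ n,
      x = π.insertIdx p (n + 1) := by
    rintro _ ⟨h, rfl⟩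
    obtain ⟨p, hp, he, -⟩ := encode_succ_spec hV hH h
    exact ⟨_, ⟨h.restrict n, rfl⟩, p, hp, he⟩
  have hlast : ∀ π ∈ encodings n (restrict H n), π.insertIdx n (n + 1) ∈ encodings (n + 1) H := by
    rintro _ ⟨g, rfl⟩
    obtain ⟨h, -, he⟩ := exists_extension_last hV hne hH g
    exact ⟨h, he⟩
  by_cases hA : ∃ A : H.edgeSet, n + 1 ∈ A.1 ∧ ∃ a ∈ A.1, a ≠ n + 1
  · refine ⟨0, hperm, hins, .inl rfl, fun _ _ _ _ => Nat.zero_le _, ?_, hlast⟩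
    rintro _ ⟨g, rfl⟩
    obtain ⟨h, -, he⟩ := exists_extension_first hV hne hH hA g
    exact ⟨h, he⟩
  · refine ⟨n, hperm, hins, .inr rfl, ?_, hlast, hlast⟩
    rintro _ ⟨g, rfl⟩ p ⟨h, he⟩
    by_contra hp
    obtain ⟨q, hq, he', -, hmax, -⟩ := encode_succ_spec hV hH h
    have hq' := hmax (by
      rintro ⟨j, hj⟩
      obtain ⟨k, ⟨hne, A, hnA, rfl⟩, -⟩ := Relation.TransGen.head'_iff.1 hj
      exact hA ⟨A, hnA, _, (h.1 A).2, hne.symm⟩)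
    have := (insertIdx_succ_inj (succ_notMem_encode _)
      (by rwa [length_encode]) (by rw [length_encode]; omega) (he'.symm.trans he)).2
    omega

/-! ### Pair flips between consecutive encodings -/

/-- `x` and `y` encode acyclic orientations that differ in a pair flip. -/
def FlipRel (n : ℕ) (H : Hypergraph ℕ) (x y : List ℕ) : Prop :=
  ∃ h h' : AO H, encode n h = x ∧ encode n h' = y ∧ (flipGraph H).Adj h h'

theorem flipRel_symm {x y : List ℕ} (h : FlipRel n H x y) : FlipRel n H y x := by
  obtain ⟨h, h', hx, hy, hadj⟩ := h
  exact ⟨h', h, hy, hx, hadj.symm⟩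

theorem IsPairFlip.adj {i j : ℕ} {h h' : AO H} (hf : IsPairFlip i j h.1 h'.1) :
    (flipGraph H).Adj h h' :=
  (SimpleGraph.fromRel_adj _ _ _).2
    ⟨fun e => hf.2.2.2.1 (congrArg Subtype.val e), .inl ⟨i, j, hf⟩⟩

theorem flipRel_of_consecutive (hV : H.vertexSet = Set.Icc 1 (n + 1))
    (hne : ∀ A ∈ H.edgeSet, A.Nonempty) (hH : IsHEO (n + 1) H) (g : AO (restrict H n)) {p q : ℕ}
    (hpq : p < q) (hq : q ≤ n) (hpL : (encode n g).insertIdx p (n + 1) ∈ encodings (n + 1) H)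
    (hqL : (encode n g).insertIdx q (n + 1) ∈ encodings (n + 1) H)
    (hr : ∀ r, p < r → r < q → (encode n g).insertIdx r (n + 1) ∉ encodings (n + 1) H) :
    FlipRel (n + 1) H ((encode n g).insertIdx p (n + 1)) ((encode n g).insertIdx q (n + 1)) := by
  obtain ⟨h, he⟩ := hpL
  obtain ⟨h', he'⟩ := hqL
  refine ⟨h, h', he, he', ?_⟩
  have hc := compatible_encode hV hH h
  have hc' := compatible_encode hV hH h'
  rw [show encode (n + 1) h = _ from he, compatible_encode_insertIdx_iff (by omega)] at hc
  rw [show encode (n + 1) h' = _ from he', compatible_encode_insertIdx_iff hq] at hc'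
  -- Moving `n + 1` to the right from `p` to `q` can change a head only to `n + 1`, and only from a
  -- vertex at a position in `[p, q)`.
  have hdiff : ∀ A, h.1 A ≠ h'.1 A → (h'.1 A : ℕ) = n + 1 ∧ (h.1 A : ℕ) ≠ n + 1 ∧
      p ≤ (encode n g).idxOf (h.1 A : ℕ) ∧ (encode n g).idxOf (h.1 A : ℕ) < q := by
    intro A hA
    have hA' : (h.1 A : ℕ) ≠ h'.1 A := fun e => hA (Subtype.ext e)
    by_cases h₁ : (h.1 A : ℕ) = n + 1
    · have h₂ : (h'.1 A : ℕ) ≠ n + 1 := fun h₂ => hA' (h₁.trans h₂.symm)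
      have h₃ := (hc A).1 h₁ _ (h'.1 A).2 h₂
      have h₄ := ((hc' A).2 h₂).1 (h₁ ▸ (h.1 A).2)
      omega
    · by_cases h₂ : (h'.1 A : ℕ) = n + 1
      · exact ⟨h₂, h₁, ((hc A).2 h₁).1 (h₂ ▸ (h'.1 A).2), (hc' A).1 h₂ _ (h.1 A).2 h₁⟩
      · exact absurd (eq_of_idxOf_encode_eq hV (h.1 A).2 h₁
          (le_antisymm (((hc' A).2 h₂).2 _ (h.1 A).2 h₁) (((hc A).2 h₁).2 _ (h'.1 A).2 h₂))) hA'
  -- If two replaced heads differ, put `n + 1` at the position of the later one, the head of `B`. In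
  -- the resulting `k`, the head of `A` is `n + 1` and that of `B` is not. The encoding of `k` may
  -- place `n + 1` elsewhere, but these two heads force its position strictly between `p` and `q`.
  have hnlt : ∀ A B, h.1 A ≠ h'.1 A → h.1 B ≠ h'.1 B →
      ¬ (encode n g).idxOf (h.1 A : ℕ) < (encode n g).idxOf (h.1 B : ℕ) := by
    intro A B hA hB hlt
    obtain ⟨-, hAn, hpA, -⟩ := hdiff A hA
    obtain ⟨hB', hBn, -, hBq⟩ := hdiff B hB
    obtain ⟨k, hkg, hk⟩ := exists_extension hV hne hH g (hBq.le.trans hq)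
    obtain ⟨r, hrn, hek, hkr, -⟩ := encode_succ_spec hV hH k
    rw [hkg] at hek hkr
    rw [compatible_encode_insertIdx_iff (hBq.le.trans hq)] at hk
    rw [compatible_encode_insertIdx_iff hrn] at hkr
    refine hr r ?_ ?_ ⟨k, hek⟩
    · have hkA : (k.1 A : ℕ) = n + 1 := by
        by_contra hkA
        have hnA : n + 1 ∈ A.1 := by
          rw [← (hdiff A hA).1]
          exact (h'.1 A).2
        have h₁ := ((hk A).2 hkA).1 hnA
        have h₂ := ((hc A).2 hAn).2 _ (k.1 A).2 hkA
        omega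
      exact hpA.trans_lt ((hkr A).1 hkA _ (h.1 A).2 hAn)
    · have hkB : (k.1 B : ℕ) ≠ n + 1 := fun hkB =>
        absurd ((hk B).1 hkB _ (h.1 B).2 hBn) (lt_irrefl _)
      have hnB : n + 1 ∈ B.1 := by
        rw [← hB']
        exact (h'.1 B).2
      exact (((hkr B).2 hkB).1 hnB).trans_lt
        ((((hc B).2 hBn).2 _ (k.1 B).2 hkB).trans_lt hBq)
  have hhh' : h.1 ≠ h'.1 := fun e => by
    have hhe := congrArg (fun h : AO H => encode (n + 1) h) (Subtype.ext e : h = h')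
    have := (insertIdx_succ_inj (succ_notMem_encode _)
      (by rw [length_encode]; omega) (by rwa [length_encode]) (he.symm.trans (hhe.trans he'))).2
    omega
  obtain ⟨A₀, hA₀⟩ := Function.ne_iff.1 hhh'
  obtain ⟨hA₀', hA₀n, hA₀p, hA₀q⟩ := hdiff A₀ hA₀
  have hm : ∀ B, h.1 B ≠ h'.1 B → (h.1 B : ℕ) = h.1 A₀ := fun B hB =>
    eq_of_idxOf_encode_eq hV (h.1 B).2 (hdiff B hB).2.1
      (le_antisymm (not_lt.1 (hnlt A₀ B hA₀ hB)) (not_lt.1 (hnlt B A₀ hB hA₀)))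
  -- The flip is described from `h'` to `h`: heads `n + 1` are replaced by the common vertex.
  refine (IsPairFlip.adj (i := h.1 A₀) (j := n + 1) ⟨mem_vertexSet A₀ (h.1 A₀).2, by simp [hV],
    hA₀n, hhh'.symm, fun A => ?_⟩ : (flipGraph H).Adj h' h).symm
  by_cases hA : h.1 A = h'.1 A
  · rw [if_neg, hA]
    rintro ⟨h₁, h₂⟩
    have := (hc A).1 (hA ▸ h₁) _ h₂ hA₀n
    omega
  · rw [if_pos ⟨(hdiff A hA).1, hm A hA ▸ (h.1 A).2⟩, hm A hA]

open Classical in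
-- If `n + 1` is last, it is the head of all its hyperedges in both orientations. If it is first,
-- the head of a larger hyperedge `A` through `n + 1` is determined by the hyperedges `X ⊆ A \ {n +
-- 1}` that join this head to the other members of `A`, and there the flip is known.
theorem IsPairFlip.extend (hV : H.vertexSet = Set.Icc 1 (n + 1)) (hH : IsHEO (n + 1) H) {p : ℕ}
    (hp : p = 0 ∨ p = n) {h h' : AO H}
    (hc : Compatible ((encode n (h.restrict n)).insertIdx p (n + 1)) h.1)
    (hc' : Compatible ((encode n (h'.restrict n)).insertIdx p (n + 1)) h'.1) {i j : ℕ}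
    (hf : IsPairFlip i j (h.restrict n).1 (h'.restrict n).1) : IsPairFlip i j h.1 h'.1 := by
  obtain ⟨hi, hj, hij, hne, hf⟩ := hf
  have hpn : p ≤ n := by omega
  rw [compatible_encode_insertIdx_iff hpn] at hc hc'
  have hjn : j ≠ n + 1 := by
    have := hj.2.2
    omega
  have hin : i ≠ n + 1 := by
    have := hi.2.2
    omega
  have hfX : ∀ X : H.edgeSet, n + 1 ∉ X.1 →
      (h'.1 X : ℕ) = if (h.1 X : ℕ) = j ∧ i ∈ X.1 then i else (h.1 X : ℕ) := fun X hX =>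
    hf ⟨X.1, X.2, subset_Icc_of_succ_notMem hV X hX⟩
  refine ⟨hi.1, hj.1, hij, fun e => hne ?_, fun A => ?_⟩
  · funext A
    exact congrFun e ⟨A.1, A.2.1⟩
  by_cases hnA : n + 1 ∈ A.1
  swap
  · exact hfX A hnA
  rcases hp with rfl | rfl
  · by_cases hA : (h.1 A : ℕ) = n + 1
    · rw [if_neg (fun e => hjn (e.1.symm.trans hA)), hA]
      by_contra hA'
      exact absurd ((hc A).1 hA _ (h'.1 A).2 hA') (Nat.not_lt_zero _)
    · have hA' : (h'.1 A : ℕ) ≠ n + 1 := fun hA' =>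
        absurd ((hc' A).1 hA' _ (h.1 A).2 hA) (Nat.not_lt_zero _)
      have hX : ∀ a ∈ A.1, a ≠ n + 1 → a ≠ (h.1 A : ℕ) → ∃ X : H.edgeSet, a ∈ X.1 ∧
          (h.1 A : ℕ) ∈ X.1 ∧ n + 1 ∉ X.1 ∧ X.1 ⊆ A.1 ∧ (h.1 X : ℕ) = h.1 A := by
        intro a ha han hne
        obtain ⟨X, haX, hAX, hnX, hXA, hX | hX⟩ := hH.isHyperfect.exists_edge h.2 hnA hnA hA ha han hne
        · exact ⟨X, haX, hAX, hnX, by simpa using hXA, hX⟩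
        · exact absurd hX.1 hX.2
      have hle : ∀ X : H.edgeSet, n + 1 ∉ X.1 → ∀ a ∈ X.1,
          (encode n (h'.restrict n)).idxOf a ≤ (encode n (h'.restrict n)).idxOf (h'.1 X : ℕ) :=
        fun X hX a ha => idxOf_le_of_restrict hV
          (compatible_encode (vertexSet_restrict hV) hH.2 _) X hX ha
      have key : ∀ m ∈ A.1, m ≠ n + 1 → (∀ a ∈ A.1, a ≠ n + 1 →
          (encode n (h'.restrict n)).idxOf a ≤ (encode n (h'.restrict n)).idxOf m) →
          (h'.1 A : ℕ) = m := fun m hm hmn hmax =>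
        eq_of_idxOf_encode_eq hV (h'.1 A).2 hA'
          (le_antisymm (hmax _ (h'.1 A).2 hA') (((hc' A).2 hA').2 m hm hmn))
      split_ifs with hcase
      · obtain ⟨hAj, hiA⟩ := hcase
        have hji : (encode n (h'.restrict n)).idxOf j ≤ (encode n (h'.restrict n)).idxOf i := by
          obtain ⟨X, hiX, hjX, hnX, -, hX⟩ := hX i hiA hin (hAj ▸ hij)
          have := hle X hnX j (hAj ▸ hjX)
          rwa [hfX X hnX, if_pos ⟨hX.trans hAj, hiX⟩] at this
        refine key i hiA hin fun a ha han => ?_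
        by_cases haA : a = (h.1 A : ℕ)
        · rw [haA, hAj]
          exact hji
        · obtain ⟨X, haX, -, hnX, -, hX⟩ := hX a ha han haA
          have := hle X hnX a haX
          rw [hfX X hnX, hX, hAj] at this
          split_ifs at this
          · exact this
          · exact this.trans hji
      · refine key _ (h.1 A).2 hA fun a ha han => ?_
        by_cases haA : a = (h.1 A : ℕ)
        · rw [haA]
        · obtain ⟨X, haX, -, hnX, hXA, hX⟩ := hX a ha han haA
          have := hle X hnX a haX
          rwa [hfX X hnX, hX, if_neg fun e => hcase ⟨e.1, hXA e.2⟩] at this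
  · have hhead : ∀ k : AO H, (Compatible ((encode p (k.restrict p)).insertIdx p (p + 1)) k.1) →
        (k.1 A : ℕ) = p + 1 := by
      intro k hk
      rw [compatible_encode_insertIdx_iff le_rfl] at hk
      by_contra hA
      exact absurd (((hk A).2 hA).1 hnA) (not_le.2 (idxOf_encode_lt hV _ A (k.1 A).2 hA))
    rw [hhead h ((compatible_encode_insertIdx_iff le_rfl).2 hc),
      hhead h' ((compatible_encode_insertIdx_iff le_rfl).2 hc'), if_neg fun e => hjn e.1.symm]

theorem flipRel_extend (hV : H.vertexSet = Set.Icc 1 (n + 1)) (hH : IsHEO (n + 1) H)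
    {p : ℕ} (hp : p = 0 ∨ p = n)
    (hext : ∀ g : AO (restrict H n), ∃ h : AO H, h.restrict n = g ∧
      encode (n + 1) h = (encode n g).insertIdx p (n + 1))
    {x y : List ℕ} (hf : FlipRel n (restrict H n) x y) :
    FlipRel (n + 1) H (x.insertIdx p (n + 1)) (y.insertIdx p (n + 1)) := by
  obtain ⟨g, g', rfl, rfl, hadj⟩ := hf
  obtain ⟨h, rfl, he⟩ := hext g
  obtain ⟨h', rfl, he'⟩ := hext g'
  have hc : ∀ k : AO H, encode (n + 1) k = (encode n (k.restrict n)).insertIdx p (n + 1) →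
      Compatible ((encode n (k.restrict n)).insertIdx p (n + 1)) k.1 := fun k hk =>
    hk ▸ compatible_encode hV hH k
  refine ⟨h, h', he, he', ?_⟩
  rcases ((SimpleGraph.fromRel_adj _ _ _).1 hadj).2 with ⟨i, j, hf⟩ | ⟨i, j, hf⟩
  · exact (hf.extend hV hH hp (hc h he) (hc h' he')).adj
  · exact (hf.extend hV hH hp (hc h' he') (hc h he)).adj.symm

end Fiber

/-! ### Algorithm J and pair flips: the induction on the number of vertices -/

theorem exists_isAlgorithmJOutput {n : ℕ} {H : Hypergraph ℕ} (hV : H.vertexSet = Set.Icc 1 n)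
    (hne : ∀ A ∈ H.edgeSet, A.Nonempty) (hH : IsHEO n H) :
    ∃ out, IsAlgorithmJOutput (encodings n H) (idPerm n) out ∧ (∀ x, x ∈ out ↔ x ∈ encodings n H) ∧
      out.IsChain (FlipRel n H) := by
  induction n generalizing H with
  | zero =>
    obtain ⟨h, hh⟩ := exists_compatible (by simp [hV]) hne []
    have hid : encodings 0 H = {[]} := by
      have : Nonempty (AO H) := ⟨⟨h, hh.isAcyclic (by simp [hV])⟩⟩
      simp [encodings, encode]
    refine ⟨[[]], ⟨by simp [hid, idPerm], by simp [idPerm], ?_, ?_⟩, by simp [hid], by simp⟩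
    · intro pre π π' post e
      have := congrArg List.length e
      simp at this
      omega
    · rintro pre π e π' ⟨v, dir, ⟨⟨d, hd, -⟩, -⟩, -⟩
      have hπ : π ∈ [[]] := e ▸ (by simp)
      rw [List.mem_singleton] at hπ
      simpa [hπ] using hd.mem
  | succ n ih =>
    obtain ⟨out, hJ, hmem, hchain⟩ := ih (vertexSet_restrict hV) (fun A hA => hne A hA.1) hH.2
    obtain ⟨c, hz⟩ := exists_isZigzag hV hne hH
    have hmem' : ∀ π ∈ out, π ∈ encodings n (restrict H n) := fun π => (hmem π).1
    refine ⟨zigzag (encodings (n + 1) H) n true out, hz.isAlgorithmJOutput hmem hJ, fun x => ?_,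
      hz.isChain_zigzag hmem' (fun _ _ => flipRel_symm) hchain ?_ ?_ ?_⟩
    · rw [mem_zigzag]
      refine ⟨fun h => h.1, fun h => ⟨h, ?_⟩⟩
      obtain ⟨π, hπ, p, hp, he⟩ := hz.exists_insertIdx x h
      exact ⟨π, (hmem π).2 hπ, p, hp, he⟩
    · rintro _ ⟨g, rfl⟩ p q hpq hq hp hq' hr
      exact flipRel_of_consecutive hV hne hH g hpq hq hp hq' hr
    · intro π _ π' _ hR
      refine flipRel_extend hV hH hz.first_or_last (fun g => ?_) hR
      -- Deleting `n + 1` from this encoding leaves both the encoding of `g` and that of the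
      -- restriction of `h`, so the restriction is `g` by injectivity.
      obtain ⟨h, he⟩ := hz.first_mem _ ⟨g, rfl⟩
      obtain ⟨p, hp, he', -⟩ := encode_succ_spec hV hH h
      exact ⟨h, encode_injective (vertexSet_restrict hV) hH.2
        (hz.eq_of_insertIdx_eq ⟨_, rfl⟩ ⟨g, rfl⟩ hp hz.le_last (he'.symm.trans he)).1, he⟩
    · exact fun π _ π' _ hR =>
        flipRel_extend hV hH (.inr rfl) (exists_extension_last hV hne hH) hR

/-! ### Simplices and Minkowski sums -/

/-- The unit vector `e_i` in `ℝⁿ`. -/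
def unitVec (n i : ℕ) : Set.Icc 1 n → ℝ := fun k => if (k : ℕ) = i then 1 else 0

theorem unitVec_eq_single {n : ℕ} (k : Set.Icc 1 n) : unitVec n k = Pi.single k 1 := by
  funext m
  simp [unitVec, Pi.single_apply, Subtype.ext_iff]

theorem sum_unitVec {n i : ℕ} (hi : i ∈ Set.Icc 1 n) : ∑ k, unitVec n i k = 1 := by
  rw [unitVec_eq_single ⟨i, hi⟩]
  simp

theorem mem_simplex_iff {n : ℕ} {S : Set ℕ} {x : Set.Icc 1 n → ℝ} :
    x ∈ simplex n S ↔ (∀ k, 0 ≤ x k) ∧ ∑ k, x k = 1 ∧ ∀ k : Set.Icc 1 n, k.1 ∉ S → x k = 0 := by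
  classical
  constructor
  · intro hx
    refine convexHull_min (t := {x : Set.Icc 1 n → ℝ | (∀ k, 0 ≤ x k) ∧ ∑ k, x k = 1 ∧
      ∀ k : Set.Icc 1 n, k.1 ∉ S → x k = 0}) ?_ ?_ hx
    · rintro _ ⟨i, hi, rfl⟩
      refine ⟨fun k => ?_, by simp, fun k hk => ?_⟩
      · rw [Pi.single_apply]
        split_ifs <;> norm_num
      · rw [Pi.single_apply, if_neg]
        rintro rfl
        exact hk hi
    · rintro x ⟨hx₁, hx₂, hx₃⟩ y ⟨hy₁, hy₂, hy₃⟩ a b ha hb hab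
      refine ⟨fun k => ?_, ?_, fun k hk => ?_⟩
      · have := hx₁ k
        have := hy₁ k
        simp only [Pi.add_apply, Pi.smul_apply, smul_eq_mul]
        positivity
      · simp only [Pi.add_apply, Pi.smul_apply, smul_eq_mul, Finset.sum_add_distrib,
          ← Finset.mul_sum, hx₂, hy₂, mul_one, hab]
      · simp [hx₃ k hk, hy₃ k hk]
  · rintro ⟨h₁, h₂, h₃⟩
    have hsub : ∀ k : Set.Icc 1 n, k ∉ Finset.univ.filter (fun k : Set.Icc 1 n => k.1 ∈ S) →
        x k = 0 := fun k hk => h₃ k (by simpa using hk)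
    have hx : x = ∑ k ∈ Finset.univ.filter (fun k : Set.Icc 1 n => k.1 ∈ S),
        x k • (Pi.single k 1 : Set.Icc 1 n → ℝ) := by
      rw [Finset.sum_subset (Finset.subset_univ _) fun k _ hk => by rw [hsub k hk, zero_smul]]
      funext m
      simp [Finset.sum_apply, Pi.single_apply]
    rw [hx]
    refine (convex_convexHull ℝ _).sum_mem (fun k _ => h₁ k) ?_ fun k hk =>
      subset_convexHull ℝ _ ⟨k, by simpa using hk, rfl⟩
    rw [Finset.sum_subset (Finset.subset_univ _) fun k _ hk => hsub k hk, h₂]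

theorem unitVec_mem_simplex {n i : ℕ} {S : Set ℕ} (hi : i ∈ Set.Icc 1 n) (hS : i ∈ S) :
    unitVec n i ∈ simplex n S :=
  subset_convexHull ℝ _ ⟨⟨i, hi⟩, hS, unitVec_eq_single ⟨i, hi⟩⟩

theorem eq_unitVec_of_mem_simplex {n b : ℕ} {S : Set ℕ} {x : Set.Icc 1 n → ℝ}
    (hx : x ∈ simplex n S) (hb : b ∈ Set.Icc 1 n) (h : ∀ k, x k ≠ 0 → (k : ℕ) = b) :
    x = unitVec n b := by
  have h0 : ∀ k : Set.Icc 1 n, (k : ℕ) ≠ b → x k = 0 := fun k hk => by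
    by_contra h'
    exact hk (h k h')
  have hsum := (mem_simplex_iff.1 hx).2.1
  rw [Finset.sum_eq_single ⟨b, hb⟩ (fun k _ hk => h0 k fun e => hk (Subtype.ext e)) (by simp)]
    at hsum
  funext k
  rw [unitVec]
  split_ifs with hk
  · rw [show k = ⟨b, hb⟩ from Subtype.ext hk, hsum]
  · exact h0 k hk

theorem eq_add_smul_of_mem_simplex {n i j : ℕ} {S : Set ℕ} {x : Set.Icc 1 n → ℝ}
    (hx : x ∈ simplex n S) (hi : i ∈ Set.Icc 1 n) (hj : j ∈ Set.Icc 1 n) (hij : i ≠ j)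
    (h : ∀ k, x k ≠ 0 → (k : ℕ) = i ∨ (k : ℕ) = j) :
    ∃ t : ℝ, 0 ≤ t ∧ t ≤ 1 ∧ x = unitVec n j + t • (unitVec n i - unitVec n j) := by
  obtain ⟨h₁, h₂, -⟩ := mem_simplex_iff.1 hx
  have hne : (⟨i, hi⟩ : Set.Icc 1 n) ≠ ⟨j, hj⟩ := fun e => hij (congrArg Subtype.val e)
  have hsum : x ⟨i, hi⟩ + x ⟨j, hj⟩ = 1 := by
    rw [← Finset.sum_pair hne, ← h₂]
    refine Finset.sum_subset (Finset.subset_univ _) fun k _ hk => ?_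
    by_contra h'
    refine hk ?_
    rw [Finset.mem_insert, Finset.mem_singleton]
    exact (h k h').imp (fun e => Subtype.ext e) fun e => Subtype.ext e
  refine ⟨x ⟨i, hi⟩, h₁ _, by linarith [h₁ ⟨j, hj⟩], ?_⟩
  funext k
  simp only [unitVec, Pi.add_apply, Pi.smul_apply, Pi.sub_apply, smul_eq_mul]
  by_cases hki : (k : ℕ) = i
  · rw [show k = ⟨i, hi⟩ from Subtype.ext hki]
    simp [hij]
  · by_cases hkj : (k : ℕ) = j
    · rw [show k = ⟨j, hj⟩ from Subtype.ext hkj]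
      simp [hij.symm]
      linarith
    · simp only [hki, hkj, if_false]
      by_contra h'
      exact (h k (by simpa using h')).elim hki hkj

/-- The linear functional with coefficients `w`. -/
noncomputable def functional (n : ℕ) (w : ℕ → ℝ) : StrongDual ℝ (Set.Icc 1 n → ℝ) :=
  ∑ k : Set.Icc 1 n, w k • ContinuousLinearMap.proj k

theorem functional_apply {n : ℕ} (w : ℕ → ℝ) (x : Set.Icc 1 n → ℝ) :
    functional n w x = ∑ k : Set.Icc 1 n, w k * x k := by
  simp [functional]

theorem functional_unitVec {n i : ℕ} (w : ℕ → ℝ) (hi : i ∈ Set.Icc 1 n) :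
    functional n w (unitVec n i) = w i := by
  rw [functional_apply, unitVec_eq_single ⟨i, hi⟩]
  simp [Pi.single_apply]

theorem functional_le_of_mem_simplex {n b : ℕ} {S : Set ℕ} {w : ℕ → ℝ} {x : Set.Icc 1 n → ℝ}
    (hx : x ∈ simplex n S) (hw : ∀ k ∈ S, w k ≤ w b) : functional n w x ≤ w b := by
  obtain ⟨h₁, h₂, h₃⟩ := mem_simplex_iff.1 hx
  rw [functional_apply, ← mul_one (w b), ← h₂, Finset.mul_sum]
  refine Finset.sum_le_sum fun k _ => ?_
  by_cases hk : k.1 ∈ S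
  · exact mul_le_mul_of_nonneg_right (hw k hk) (h₁ k)
  · simp [h₃ k hk]

theorem eq_of_le_functional {n b : ℕ} {S : Set ℕ} {w : ℕ → ℝ} {x : Set.Icc 1 n → ℝ}
    (hx : x ∈ simplex n S) (hw : ∀ k ∈ S, w k ≤ w b) (h : w b ≤ functional n w x)
    (k : Set.Icc 1 n) (hk : x k ≠ 0) : k.1 ∈ S ∧ w k = w b := by
  obtain ⟨h₁, h₂, h₃⟩ := mem_simplex_iff.1 hx
  have hkS : k.1 ∈ S := by
    by_contra hkS
    exact hk (h₃ k hkS)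
  refine ⟨hkS, le_antisymm (hw k hkS) (not_lt.1 fun hlt => ?_)⟩
  refine absurd h (not_le.2 ?_)
  rw [functional_apply, ← mul_one (w b), ← h₂, Finset.mul_sum]
  refine Finset.sum_lt_sum (fun k _ => ?_) ⟨k, Finset.mem_univ k,
    mul_lt_mul_of_pos_right hlt ((h₁ k).lt_of_ne' hk)⟩
  by_cases hk : k.1 ∈ S
  · exact mul_le_mul_of_nonneg_right (hw k hk) (h₁ k)
  · simp [h₃ k hk]

/-! ### Extreme points of Minkowski sums -/

section Minkowski

open scoped Pointwise

variable {I E : Type*} [Fintype I] [AddCommGroup E] {S : I → Set E} {x : I → E}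

theorem sum_update [DecidableEq I] (x : I → E) (i : I) (a : E) :
    ∑ j, Function.update x i a j = ∑ j, x j + (a - x i) := by
  rw [Finset.sum_update_of_mem (Finset.mem_univ i),
    ← Finset.add_sum_erase _ _ (Finset.mem_univ i), ← Finset.sdiff_singleton_eq_erase]
  abel

theorem sum_update_mem [DecidableEq I] (hx : ∀ i, x i ∈ S i) {i : I} {a : E} (ha : a ∈ S i) :
    ∑ j, x j + (a - x i) ∈ ∑ i, S i := by
  rw [Set.mem_fintype_sum, ← sum_update]
  refine ⟨_, fun j => ?_, rfl⟩
  by_cases hj : j = i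
  · subst hj; simpa using ha
  · simpa [hj] using hx j

variable [Module ℝ E]

/-- An extreme point of a Minkowski sum has a unique decomposition. -/
theorem eq_of_sum_mem_extremePoints (hx : ∀ i, x i ∈ S i) {y : I → E} (hy : ∀ i, y i ∈ S i)
    (h : ∑ i, x i = ∑ i, y i) (hext : ∑ i, x i ∈ (∑ i, S i).extremePoints ℝ) : x = y := by
  classical
  funext i
  -- Exchanging the `i`-th summands of the two decompositions gives two points of the sum whose
  -- midpoint is the extreme point.
  have h₁ := sum_update_mem hx (hy i)
  have h₂ := sum_update_mem hy (hx i)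
  have := (hext.2 h₁ h₂ ⟨1 / 2, 1 / 2, by norm_num, by norm_num, by norm_num, by
    rw [← h, ← smul_add, show ∑ j, x j + (y i - x i) + (∑ j, x j + (x i - y i)) =
      (2 : ℝ) • ∑ j, x j by rw [two_smul]; abel, smul_smul]
    norm_num⟩)
  have h₃ : y i - x i = 0 := by simpa using this
  exact (sub_eq_zero.1 h₃).symm

/-- The summands of an extreme point of a Minkowski sum are extreme points. -/
theorem mem_extremePoints_of_sum (hx : ∀ i, x i ∈ S i)
    (hext : ∑ i, x i ∈ (∑ i, S i).extremePoints ℝ) (i : I) : x i ∈ (S i).extremePoints ℝ := by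
  classical
  refine ⟨hx i, fun a ha b hb hab => ?_⟩
  obtain ⟨s, t, hs, ht, hst, he⟩ := hab
  have := hext.2 (sum_update_mem hx ha) (sum_update_mem hx hb) ⟨s, t, hs, ht, hst, by
    have : s • (∑ j, x j + (a - x i)) + t • (∑ j, x j + (b - x i)) =
        (s + t) • ∑ j, x j + ((s • a + t • b) - (s + t) • x i) := by module
    rw [this, hst, he, one_smul, one_smul, sub_self, add_zero]⟩
  have h₃ : a - x i = 0 := by simpa using this
  exact sub_eq_zero.1 h₃

end Minkowski

/-! ### The skeleton of the hypergraphic polytope -/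

section Polytope

open scoped Pointwise

variable {n : ℕ} {H : Hypergraph ℕ}

theorem finite_edgeSet (hV : H.vertexSet = Set.Icc 1 n) : Finite H.edgeSet := by
  have : (𝒫 (Set.Icc 1 n)).Finite := (Set.finite_Icc 1 n).finite_subsets
  exact (this.subset fun A hA => hV ▸ H.subset_vertexSet_of_mem_edgeSet' hA).to_subtype

theorem mem_Icc_of_mem (hV : H.vertexSet = Set.Icc 1 n) {A : H.edgeSet} {a : ℕ} (ha : a ∈ A.1) :
    a ∈ Set.Icc 1 n :=
  hV ▸ mem_vertexSet A ha

theorem head_mem_Icc (hV : H.vertexSet = Set.Icc 1 n) (h : Orientation H) (A : H.edgeSet) :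
    (h A : ℕ) ∈ Set.Icc 1 n :=
  mem_Icc_of_mem hV (h A).2

theorem unitVec_head_mem (hV : H.vertexSet = Set.Icc 1 n) (h : Orientation H) (A : H.edgeSet) :
    unitVec n (h A : ℕ) ∈ simplex n A :=
  unitVec_mem_simplex (head_mem_Icc hV h A) (h A).2

variable [Fintype H.edgeSet]

theorem polytope_eq_sum : polytope n H = ∑ A : H.edgeSet, simplex n A :=
  finsum_eq_sum_of_fintype _

theorem mem_polytope_iff {x : Set.Icc 1 n → ℝ} :
    x ∈ polytope n H ↔ ∃ y : H.edgeSet → Set.Icc 1 n → ℝ,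
      (∀ A : H.edgeSet, y A ∈ simplex n A) ∧ ∑ A, y A = x := by
  rw [polytope_eq_sum, Set.mem_fintype_sum]
  simp

theorem inDegree_eq_sum (h : Orientation H) :
    inDegree n h = ∑ A, unitVec n (h A : ℕ) := by
  classical
  funext k
  rw [inDegree, Finset.sum_apply, Set.ncard_eq_toFinset_card']
  simp [unitVec, eq_comm]

theorem inDegree_mem_polytope (hV : H.vertexSet = Set.Icc 1 n) (h : Orientation H) :
    inDegree n h ∈ polytope n H :=
  mem_polytope_iff.2 ⟨_, unitVec_head_mem hV h, (inDegree_eq_sum h).symm⟩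

theorem functional_inDegree (hV : H.vertexSet = Set.Icc 1 n) (h : Orientation H) (w : ℕ → ℝ) :
    functional n w (inDegree n h) = ∑ A, w (h A : ℕ) := by
  rw [inDegree_eq_sum, map_sum]
  exact Finset.sum_congr rfl fun A _ => functional_unitVec w (head_mem_Icc hV h A)

/-- If the heads have maximal weight in their hyperedges, then the in-degree sequence maximizes the
weight, and the maximizers are the sums of maximizers. -/
theorem le_functional_inDegree (hV : H.vertexSet = Set.Icc 1 n) {h : Orientation H} {w : ℕ → ℝ}
    (hw : ∀ A : H.edgeSet, ∀ k ∈ A.1, w k ≤ w (h A : ℕ)) {x : Set.Icc 1 n → ℝ} (hx : x ∈ polytope n H) :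
    functional n w x ≤ functional n w (inDegree n h) := by
  obtain ⟨y, hy, rfl⟩ := mem_polytope_iff.1 hx
  rw [functional_inDegree hV, map_sum]
  exact Finset.sum_le_sum fun A _ => functional_le_of_mem_simplex (hy A) (hw A)

theorem exists_sum_of_functional_eq (hV : H.vertexSet = Set.Icc 1 n) {h : Orientation H}
    {w : ℕ → ℝ} (hw : ∀ A : H.edgeSet, ∀ k ∈ A.1, w k ≤ w (h A : ℕ)) {x : Set.Icc 1 n → ℝ}
    (hx : x ∈ polytope n H) (hle : functional n w (inDegree n h) ≤ functional n w x) :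
    ∃ y : H.edgeSet → Set.Icc 1 n → ℝ, (∀ A : H.edgeSet, y A ∈ simplex n A) ∧ ∑ A, y A = x ∧
      ∀ A k, y A k ≠ 0 → k.1 ∈ A.1 ∧ w k = w (h A : ℕ) := by
  obtain ⟨y, hy, rfl⟩ := mem_polytope_iff.1 hx
  refine ⟨y, hy, rfl, fun A => eq_of_le_functional (hy A) (hw A) ?_⟩
  rw [functional_inDegree hV, map_sum] at hle
  by_contra hlt
  exact absurd hle (not_le.2 (Finset.sum_lt_sum
    (fun B _ => functional_le_of_mem_simplex (hy B) (hw B)) ⟨A, Finset.mem_univ A, not_le.1 hlt⟩))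

/-- The numbers of elements of `{1, …, n}` in two sets, one of which is properly contained in the
other. -/
theorem ncard_lt_ncard_of_ssubset {W W' : Set ℕ} (hsub : W ⊆ W') {a : ℕ} (ha : a ∈ Set.Icc 1 n)
    (ha' : a ∈ W') (haW : a ∉ W) :
    ((W ∩ Set.Icc 1 n).ncard : ℝ) < ((W' ∩ Set.Icc 1 n).ncard : ℝ) := by
  rw [Nat.cast_lt]
  refine Set.ncard_lt_ncard ⟨Set.inter_subset_inter_left _ hsub, fun h => haW (h ⟨ha', ha⟩).1⟩
    ((Set.finite_Icc 1 n).inter_of_right _)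

/-- Weight each vertex by its number of predecessors. This increases strictly along arcs, so in each
simplex the unit vector at the head is the only maximizer. -/
theorem inDegree_mem_extremePoints (hV : H.vertexSet = Set.Icc 1 n) {h : Orientation H}
    (hh : IsAcyclic h) : inDegree n h ∈ (polytope n H).extremePoints ℝ := by
  apply exposedPoints_subset_extremePoints
  let w : ℕ → ℝ := fun v => (({u | Prec h u v} ∩ Set.Icc 1 n).ncard : ℝ)
  have hlt : ∀ A : H.edgeSet, ∀ k ∈ A.1, k ≠ (h A : ℕ) → w k < w (h A : ℕ) := fun A k hk hne =>
    ncard_lt_ncard_of_ssubset (fun u hu => Relation.TransGen.tail hu (Arc.of_mem h hk hne))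
      (mem_Icc_of_mem hV hk) (Relation.TransGen.single (Arc.of_mem h hk hne)) (hh k)
  have hw : ∀ A : H.edgeSet, ∀ k ∈ A.1, w k ≤ w (h A : ℕ) := fun A k hk => by
    by_cases hne : k = (h A : ℕ)
    · rw [hne]
    · exact (hlt A k hk hne).le
  refine ⟨inDegree_mem_polytope hV h, functional n w, fun x hx =>
    ⟨le_functional_inDegree hV hw hx, fun hle => ?_⟩⟩
  obtain ⟨y, hy, rfl, hyk⟩ := exists_sum_of_functional_eq hV hw hx hle
  rw [inDegree_eq_sum]
  refine Finset.sum_congr rfl fun A _ =>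
    eq_unitVec_of_mem_simplex (hy A) (head_mem_Icc hV h A) fun k hk => ?_
  by_contra hne
  exact (hlt A k (hyk A k hk).1 hne).ne (hyk A k hk).2

theorem eq_of_unitVec_eq {i j : ℕ} (hi : i ∈ Set.Icc 1 n) (h : unitVec n i = unitVec n j) : i = j := by
  by_contra hne
  have := congrFun h ⟨i, hi⟩
  simp [unitVec, hne] at this

theorem inDegree_injective (hV : H.vertexSet = Set.Icc 1 n) {h h' : Orientation H}
    (hh : IsAcyclic h) (he : inDegree n h = inDegree n h') : h = h' := by
  have hext := inDegree_mem_extremePoints hV hh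
  rw [polytope_eq_sum, inDegree_eq_sum] at hext
  rw [inDegree_eq_sum, inDegree_eq_sum] at he
  have := eq_of_sum_mem_extremePoints (unitVec_head_mem hV h) (unitVec_head_mem hV h') he hext
  funext A
  exact Subtype.ext (eq_of_unitVec_eq (head_mem_Icc hV h A) (congrFun this A))

/-- A direction in which the sum of unit vectors at the heads can be redistributed to other members
of the hyperedges, with total change `e_u - e_v`. -/
def IsRedistribution (h : Orientation H) (u v : ℕ) (d : H.edgeSet → Set.Icc 1 n → ℝ) : Prop :=
  (∀ A (k : Set.Icc 1 n), k.1 ≠ h A → 0 ≤ d A k) ∧ (∀ A, ∑ k, d A k = 0) ∧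
    (∀ (A : H.edgeSet) (k : Set.Icc 1 n), k.1 ∉ A.1 → d A k = 0) ∧
    (∃ (A : H.edgeSet) (k : Set.Icc 1 n), k.1 ≠ h A ∧ 0 < d A k) ∧
    ∑ A, d A = unitVec n u - unitVec n v

/-- A path in the digraph of an orientation gives a direction of redistribution. -/
theorem exists_redistribution (hV : H.vertexSet = Set.Icc 1 n) (h : Orientation H) {u v : ℕ}
    (huv : Prec h u v) : ∃ d : H.edgeSet → Set.Icc 1 n → ℝ, IsRedistribution h u v d := by
  classical
  have harc : ∀ {u v}, Arc h u v → ∃ d : H.edgeSet → Set.Icc 1 n → ℝ, IsRedistribution h u v d := by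
    rintro u v ⟨hne, A, hA, rfl⟩
    have hu := mem_Icc_of_mem hV hA
    -- Along an arc, mass moves from the head to `u` inside the single summand of `A`.
    refine ⟨Pi.single A (unitVec n u - unitVec n (h A)), fun B k hk => ?_, fun B => ?_,
      fun B k hk => ?_, ⟨A, ⟨u, hu⟩, hne, ?_⟩, Finset.sum_pi_single' _ _ _ |>.trans (by simp)⟩
    · by_cases hB : B = A
      · subst hB
        simp only [Pi.single_eq_same, Pi.sub_apply, unitVec, hk, if_false, sub_zero]
        split_ifs <;> norm_num
      · simp [hB]
    · by_cases hB : B = A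
      · subst hB
        simp [sum_unitVec hu, sum_unitVec (head_mem_Icc hV h B)]
      · simp [hB]
    · by_cases hB : B = A
      · subst hB
        have h₁ : (k : ℕ) ≠ u := fun e => hk (e ▸ hA)
        have h₂ : (k : ℕ) ≠ h B := fun e => hk (e ▸ (h B).2)
        simp [unitVec, h₁, h₂]
      · simp [hB]
    · simp [unitVec, hne]
  induction huv with
  | single huv => exact harc huv
  | tail _ hvw ih =>
    obtain ⟨d, h₁, h₂, h₃, ⟨A, k, hk, hpos⟩, h₅⟩ := ih
    obtain ⟨d', h₁', h₂', h₃', -, h₅'⟩ := harc hvw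
    refine ⟨d + d', fun B m hm => add_nonneg (h₁ B m hm) (h₁' B m hm), fun B => ?_,
      fun B m hm => ?_, ⟨A, k, hk, add_pos_of_pos_of_nonneg hpos (h₁' A k hk)⟩, ?_⟩
    · simp [Finset.sum_add_distrib, h₂, h₂']
    · simp [h₃ B m hm, h₃' B m hm]
    · simp only [Pi.add_apply, Finset.sum_add_distrib, h₅, h₅']
      abel

/-- Redistribution along a cycle has total change zero but changes some summand, so a small multiple
of it gives a second decomposition of the same extreme point. -/
theorem isAcyclic_of_mem_extremePoints (hV : H.vertexSet = Set.Icc 1 n) {h : Orientation H}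
    (hext : inDegree n h ∈ (polytope n H).extremePoints ℝ) : IsAcyclic h := by
  intro i hi
  obtain ⟨d, h₁, h₂, h₃, ⟨A, k, hk, hpos⟩, h₅⟩ := exists_redistribution hV h hi
  -- A head has coordinate 1, so it stays nonnegative when each change is at least -1; the other
  -- coordinates do not decrease.
  obtain ⟨ε, hε, hεd⟩ : ∃ ε : ℝ, 0 < ε ∧ ∀ (B : H.edgeSet) (m : Set.Icc 1 n), -1 ≤ ε * d B m := by
    refine ⟨1 / (1 + ∑ B, ∑ m, |d B m|), by positivity, fun B m => ?_⟩
    have hle : |d B m| ≤ ∑ B, ∑ m, |d B m| :=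
      (Finset.single_le_sum (f := fun m => |d B m|) (fun _ _ => abs_nonneg _)
        (Finset.mem_univ m)).trans (Finset.single_le_sum (f := fun B => ∑ m, |d B m|)
          (fun _ _ => Finset.sum_nonneg fun _ _ => abs_nonneg _) (Finset.mem_univ B))
    have hpos' : 0 < 1 + ∑ B, ∑ m, |d B m| := by positivity
    rw [one_div, inv_mul_eq_div, le_div_iff₀ hpos']
    linarith [neg_abs_le (d B m)]
  have hmem : ∀ B : H.edgeSet, unitVec n (h B : ℕ) + ε • d B ∈ simplex n B := by
    intro B
    refine mem_simplex_iff.2 ⟨fun m => ?_, ?_, fun m hm => ?_⟩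
    · simp only [unitVec, Pi.add_apply, Pi.smul_apply, smul_eq_mul]
      split_ifs with hm
      · linarith [hεd B m]
      · have := h₁ B m hm
        positivity
    · simp [Finset.sum_add_distrib, ← Finset.mul_sum, h₂, sum_unitVec (head_mem_Icc hV h B)]
    · have h₂ : (m : ℕ) ≠ h B := fun e => hm (e ▸ (h B).2)
      simp [unitVec, h₂, h₃ B m hm]
  have hsum : ∑ B, unitVec n (h B : ℕ) = ∑ B, (unitVec n (h B : ℕ) + ε • d B) := by
    rw [Finset.sum_add_distrib, ← Finset.smul_sum, h₅, sub_self, smul_zero, add_zero]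
  rw [polytope_eq_sum, inDegree_eq_sum] at hext
  have := congrFun (congrFun
    (eq_of_sum_mem_extremePoints (unitVec_head_mem hV h) hmem hsum hext) A) k
  simp only [Pi.add_apply, Pi.smul_apply, smul_eq_mul, left_eq_add, mul_eq_zero] at this
  rcases this with h | h
  · exact hε.ne' h
  · exact hpos.ne' h

theorem exists_inDegree_eq (hV : H.vertexSet = Set.Icc 1 n) {x : Set.Icc 1 n → ℝ}
    (hx : x ∈ (polytope n H).extremePoints ℝ) :
    ∃ h : Orientation H, IsAcyclic h ∧ inDegree n h = x := by
  obtain ⟨y, hy, rfl⟩ := mem_polytope_iff.1 hx.1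
  have hx' := hx
  rw [polytope_eq_sum] at hx'
  have : ∀ A : H.edgeSet, ∃ a : A.1, y A = unitVec n a := fun A => by
    obtain ⟨i, hi, he⟩ := extremePoints_convexHull_subset (mem_extremePoints_of_sum hy hx' A)
    exact ⟨⟨i, hi⟩, he.trans (unitVec_eq_single i).symm⟩
  choose h hh using this
  have he : inDegree n h = ∑ A, y A := by
    rw [inDegree_eq_sum]
    exact Finset.sum_congr rfl fun A _ => (hh A).symm
  exact ⟨h, isAcyclic_of_mem_extremePoints hV (he ▸ hx), he⟩

end Polytope

section Edges

open scoped Pointwise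

variable {n : ℕ} {H : Hypergraph ℕ}

/-! ### Weights for pair flips -/

/-- The flip affects only hyperedges with head `j`, and by acyclicity a path ending strictly below
`j` uses none of them. -/
theorem IsPairFlip.prec_of_prec {i j : ℕ} {h h' : Orientation H} (hf : IsPairFlip i j h h')
    (hh : IsAcyclic h) {u v : ℕ} (huv : Prec h u v) (hvj : Prec h v j) : Prec h' u v := by
  have harc : ∀ {u v}, Arc h u v → v ≠ j → Arc h' u v := by
    rintro u v ⟨hne, A, hA, rfl⟩ hvj
    exact ⟨hne, A, hA, by rw [hf.2.2.2.2, if_neg fun e => hvj e.1]⟩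
  have hne : ∀ {v}, Prec h v j → v ≠ j := fun hv e => hh j (e ▸ hv)
  induction huv with
  | single huv => exact .single (harc huv (hne hvj))
  | tail _ hbv ih => exact (ih (.head hbv hvj)).tail (harc hbv (hne hvj))

theorem IsPairFlip.exists_edge {i j : ℕ} {h h' : Orientation H} (hf : IsPairFlip i j h h') :
    ∃ A : H.edgeSet, (h A : ℕ) = j ∧ i ∈ A.1 ∧ (h' A : ℕ) = i := by
  obtain ⟨A, hA⟩ := Function.ne_iff.1 hf.2.2.2.1
  have := hf.2.2.2.2 A
  split_ifs at this with hc
  · exact ⟨A, hc.1, hc.2, this⟩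
  · exact absurd (Subtype.ext this.symm) hA

/-- Take the last arc from `x` to `j`, given by `A`. The path from `i` to `x` survives the flip. If
`i ∈ A`, the new head `i` closes a cycle through `x`; otherwise `A` keeps its head `j`, and a
flipped hyperedge gives the arc from `j` back to `i`. -/
theorem IsPairFlip.not_between {i j : ℕ} {h h' : Orientation H} (hf : IsPairFlip i j h h')
    (hh : IsAcyclic h) (hh' : IsAcyclic h') {a : ℕ} (hia : Prec h i a) (haj : Prec h a j) :
    False := by
  obtain ⟨x, hax, hne, A, hxA, hA⟩ := Relation.TransGen.tail'_iff.1 haj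
  have hxj : Prec h x j := .single ⟨hne, A, hxA, hA⟩
  have hix : Prec h i x := Relation.TransGen.trans_left hia hax
  have hix' := hf.prec_of_prec hh hix hxj
  have hxi : x ≠ i := fun e => hh i (e ▸ hix)
  have hA' := hf.2.2.2.2 A
  split_ifs at hA' with hc
  · exact hh' i (hix'.tail ⟨hxi, A, hxA, hA'⟩)
  · obtain ⟨A₀, hj, -, hi⟩ := hf.exists_edge
    have hjA₀ : j ∈ A₀.1 := by
      rw [← hj]
      exact (h A₀).2
    exact hh' i ((hix'.tail ⟨hne, A, hxA, hA'.trans hA⟩).tail ⟨hf.2.2.1.symm, A₀, hjA₀, hi⟩)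

/-- A pair flip identifies two vertices in a linear order. -/
theorem IsPairFlip.exists_weight (hV : H.vertexSet = Set.Icc 1 n) {i j : ℕ} {h h' : Orientation H}
    (hf : IsPairFlip i j h h') (hh : IsAcyclic h) (hh' : IsAcyclic h') :
    ∃ w : ℕ → ℝ, w i = w j ∧
      ∀ A : H.edgeSet, ∀ a ∈ A.1, a ≠ h A → ¬ (a = i ∧ (h A : ℕ) = j) → w a < w (h A : ℕ) := by
  classical
  have hij : Prec h i j := by
    obtain ⟨A, hj, hiA, -⟩ := hf.exists_edge
    exact .single ⟨hf.2.2.1, A, hiA, hj⟩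
  have hjIcc : j ∈ Set.Icc 1 n := hV ▸ hf.2.1
  -- Predecessor sets after merging `i` and `j`: the merged vertex lies above what was below `j`,
  -- apart from `i`, and a vertex above `i` also inherits `j` and everything below `j`. As nothing
  -- lies between `i` and `j`, these sets grow strictly along the remaining arcs.
  let W : ℕ → Set ℕ := fun v => if v = i ∨ v = j then {u | Prec h u j ∧ u ≠ i}
    else {u | Prec h u v ∨ Prec h i v ∧ (u = j ∨ Prec h u j)}
  refine ⟨fun v => ((W v ∩ Set.Icc 1 n).ncard : ℝ), by simp [W], fun A a ha hne hnot => ?_⟩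
  have harc : Arc h a (h A) := Arc.of_mem h ha hne
  have haIcc := mem_Icc_of_mem hV ha
  generalize (h A : ℕ) = b at hne hnot harc ⊢
  change ((W a ∩ Set.Icc 1 n).ncard : ℝ) < ((W b ∩ Set.Icc 1 n).ncard : ℝ)
  have hbt := fun {a} => hf.not_between hh hh' (a := a)
  by_cases hb : b = i ∨ b = j
  · have hWb : W b = {u | Prec h u j ∧ u ≠ i} := if_pos hb
    have ha' : ¬ (a = i ∨ a = j) := by
      rintro (rfl | rfl)
      · exact hb.elim (fun e => hne e.symm) fun e => hnot ⟨rfl, e⟩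
      · rcases hb with rfl | rfl
        · exact hh _ (hij.tail harc)
        · exact hne rfl
    have hWa : W a = {u | Prec h u a ∨ Prec h i a ∧ (u = j ∨ Prec h u j)} := if_neg ha'
    have haj : Prec h a j := by
      rcases hb with rfl | rfl
      · exact .head harc hij
      · exact .single harc
    have hnia : ¬ Prec h i a := fun hia => hbt hia haj
    rw [hWa, hWb]
    refine ncard_lt_ncard_of_ssubset ?_ haIcc ⟨haj, fun e => ha' (.inl e)⟩ ?_
    · rintro u (hu | hu)
      · exact ⟨hu.trans haj, fun e => hnia (e ▸ hu)⟩
      · exact absurd hu.1 hnia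
    · rintro (hu | hu)
      · exact hh a hu
      · exact hnia hu.1
  · have hWb : W b = {u | Prec h u b ∨ Prec h i b ∧ (u = j ∨ Prec h u j)} := if_neg hb
    rw [hWb]
    by_cases ha' : a = i ∨ a = j
    · have hWa : W a = {u | Prec h u j ∧ u ≠ i} := if_pos ha'
      rw [hWa]
      refine ncard_lt_ncard_of_ssubset (a := j) (fun u hu => ?_) hjIcc ?_ fun hu => hh j hu.1
      · rcases ha' with rfl | rfl
        · exact .inr ⟨.single harc, .inr hu.1⟩
        · exact .inl (hu.1.tail harc)
      · rcases ha' with rfl | rfl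
        · exact .inr ⟨.single harc, .inl rfl⟩
        · exact .inl (.single harc)
    · have hWa : W a = {u | Prec h u a ∨ Prec h i a ∧ (u = j ∨ Prec h u j)} := if_neg ha'
      rw [hWa]
      refine ncard_lt_ncard_of_ssubset (fun u hu => ?_) haIcc (.inl (.single harc)) ?_
      · exact hu.imp (fun hu => hu.tail harc) fun hu => ⟨hu.1.tail harc, hu.2⟩
      · rintro (hu | ⟨hia, rfl | haj⟩)
        · exact hh a hu
        · exact ha' (.inr rfl)
        · exact hbt hia haj

/-! ### Exposed segments give pair flips -/

/-- Both differences are nonzero, so they are positive multiples of `D`; the sign of `D` is positive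
only at `i` and negative only at `j`. -/
theorem eq_of_parallel {i j a b : ℕ} (hi : i ∈ Set.Icc 1 n)
    (ha : a ∈ Set.Icc 1 n) (hb : b ∈ Set.Icc 1 n) (hij : i ≠ j) (hab : a ≠ b)
    {D : Set.Icc 1 n → ℝ} {s t : ℝ} (hs : 0 ≤ s) (ht : 0 ≤ t)
    (h₁ : unitVec n i - unitVec n j = s • D) (h₂ : unitVec n a - unitVec n b = t • D) :
    a = i ∧ b = j := by
  have e₁ := congrFun h₁ ⟨a, ha⟩
  have e₂ := congrFun h₂ ⟨a, ha⟩
  have e₃ := congrFun h₁ ⟨b, hb⟩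
  have e₄ := congrFun h₂ ⟨b, hb⟩
  have e₅ := congrFun h₁ ⟨i, hi⟩
  simp only [unitVec, Pi.sub_apply, Pi.smul_apply, smul_eq_mul, if_true, hij, hab, hab.symm,
    if_false] at e₁ e₂ e₃ e₄ e₅
  have hs' : 0 < s := hs.lt_of_ne' fun e => by simp [e] at e₅
  have ht' : 0 < t := ht.lt_of_ne' fun e => by simp [e] at e₂
  have hDa : 0 < D ⟨a, ha⟩ := by
    by_contra h
    have := mul_nonpos_of_nonneg_of_nonpos ht (not_lt.1 h)
    linarith
  have hDb : D ⟨b, hb⟩ < 0 := by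
    by_contra h
    have := mul_nonneg ht (not_lt.1 h)
    linarith
  have h₃ := mul_pos hs' hDa
  have h₄ := mul_neg_of_pos_of_neg hs' hDb
  constructor
  · by_contra h
    rw [← e₁, if_neg h] at h₃
    split_ifs at h₃ <;> norm_num at h₃
  · by_contra h
    rw [← e₃, if_neg h] at h₄
    split_ifs at h₄ <;> norm_num at h₄

variable [Fintype H.edgeSet]

theorem inDegree_add_mem_polytope (hV : H.vertexSet = Set.Icc 1 n) (h : Orientation H)
    {A : H.edgeSet} {a : ℕ} (ha : a ∈ A.1) :
    inDegree n h + (unitVec n a - unitVec n (h A : ℕ)) ∈ polytope n H := by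
  classical
  rw [inDegree_eq_sum, polytope_eq_sum]
  exact sum_update_mem (unitVec_head_mem hV h)
    (unitVec_mem_simplex (mem_Icc_of_mem hV ha) ha)

/-- Changing one head in an exposed face. -/
theorem unitVec_sub_eq_smul (hV : H.vertexSet = Set.Icc 1 n) {h h' : Orientation H}
    {l : StrongDual ℝ (Set.Icc 1 n → ℝ)}
    (hl : segment ℝ (inDegree n h) (inDegree n h') =
      {x ∈ polytope n H | ∀ y ∈ polytope n H, l y ≤ l x}) (A : H.edgeSet) {a : ℕ} (ha : a ∈ A.1) :
    l (unitVec n a) ≤ l (unitVec n (h A : ℕ)) ∧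
      (l (unitVec n a) = l (unitVec n (h A : ℕ)) → ∃ t : ℝ, 0 ≤ t ∧
        unitVec n a - unitVec n (h A : ℕ) = t • (inDegree n h' - inDegree n h)) := by
  have hmem := inDegree_add_mem_polytope hV h ha
  have hh : inDegree n h ∈ {x ∈ polytope n H | ∀ y ∈ polytope n H, l y ≤ l x} :=
    hl ▸ left_mem_segment ℝ _ _
  constructor
  · have := hh.2 _ hmem
    rw [map_add, map_sub] at this
    linarith
  · intro he
    have : inDegree n h + (unitVec n a - unitVec n (h A : ℕ)) ∈
        segment ℝ (inDegree n h) (inDegree n h') := by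
      rw [hl]
      refine ⟨hmem, fun y hy => ?_⟩
      rw [map_add, map_sub, he, sub_self, add_zero]
      exact hh.2 y hy
    rw [segment_eq_image'] at this
    obtain ⟨t, ht, he'⟩ := this
    exact ⟨t, ht.1, (add_left_cancel he').symm⟩

/-- The functional `l` that exposes the segment agrees on old and new heads, so each head change is
parallel to the segment and uses the pair of `A₀`. -/
theorem exists_isPairFlip_of_isExposed (hV : H.vertexSet = Set.Icc 1 n) {h h' : Orientation H}
    (hne : h ≠ h')
    (hexp : IsExposed ℝ (polytope n H) (segment ℝ (inDegree n h) (inDegree n h'))) :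
    ∃ i j, IsPairFlip i j h h' := by
  obtain ⟨l, hl⟩ := hexp ⟨_, left_mem_segment ℝ _ _⟩
  have hl' := hl
  rw [segment_symm] at hl'
  have heq : ∀ A, l (unitVec n (h A : ℕ)) = l (unitVec n (h' A : ℕ)) := fun A =>
    le_antisymm (unitVec_sub_eq_smul hV hl' A (h A).2).1 (unitVec_sub_eq_smul hV hl A (h' A).2).1
  obtain ⟨A₀, hA₀⟩ := Function.ne_iff.1 hne
  have hA₀' : (h' A₀ : ℕ) ≠ h A₀ := fun e => hA₀ (Subtype.ext e.symm)
  obtain ⟨s, hs, hs'⟩ := (unitVec_sub_eq_smul hV hl A₀ (h' A₀).2).2 (heq A₀).symm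
  obtain ⟨s', hs₁, hs₁'⟩ := (unitVec_sub_eq_smul hV hl' A₀ (h A₀).2).2 (heq A₀)
  have key : ∀ A : H.edgeSet, ∀ a ∈ A.1, a ≠ (h A : ℕ) →
      l (unitVec n a) = l (unitVec n (h A : ℕ)) → a = h' A₀ ∧ (h A : ℕ) = h A₀ := by
    intro A a ha hne he
    obtain ⟨t, ht, ht'⟩ := (unitVec_sub_eq_smul hV hl A ha).2 he
    exact eq_of_parallel (head_mem_Icc hV h' A₀) (mem_Icc_of_mem hV ha)
      (head_mem_Icc hV h A) hA₀' hne hs ht hs' ht'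
  have key' : ∀ A : H.edgeSet, ∀ a ∈ A.1, a ≠ (h' A : ℕ) →
      l (unitVec n a) = l (unitVec n (h' A : ℕ)) → a = h A₀ ∧ (h' A : ℕ) = h' A₀ := by
    intro A a ha hne he
    obtain ⟨t, ht, ht'⟩ := (unitVec_sub_eq_smul hV hl' A ha).2 he
    exact eq_of_parallel (head_mem_Icc hV h A₀) (mem_Icc_of_mem hV ha)
      (head_mem_Icc hV h' A) hA₀'.symm hne hs₁ ht hs₁' ht'
  refine ⟨h' A₀, h A₀, mem_vertexSet A₀ (h' A₀).2, mem_vertexSet A₀ (h A₀).2, hA₀', hne,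
    fun A => ?_⟩
  split_ifs with hc
  -- A hyperedge with the old head that contains the new one must flip: otherwise replacing its head
  -- in `h'` by the new vertex stays in the face but, by `key'`, points the wrong way.
  · by_contra hne'
    refine hA₀' (key' A _ hc.2 (Ne.symm hne') ?_).1
    rw [← heq A, ← heq A₀, hc.1]
  · by_contra hne'
    obtain ⟨h₁, h₂⟩ := key A _ (h' A).2 hne' (heq A).symm
    exact hc ⟨h₂, h₁ ▸ (h' A).2⟩

/-! ### Pair flips give exposed segments -/

/-- For a weight that ties only `i` and `j`, a flipped hyperedge contributes the segment from $e_j$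
to $e_i$ to the maximal face and any other contributes one point. A sum of parallel segments is a
segment. -/
theorem IsPairFlip.isExposed (hV : H.vertexSet = Set.Icc 1 n) {i j : ℕ} {h h' : Orientation H}
    (hf : IsPairFlip i j h h') (hh : IsAcyclic h) (hh' : IsAcyclic h') :
    IsExposed ℝ (polytope n H) (segment ℝ (inDegree n h) (inDegree n h')) := by
  classical
  intro _
  obtain ⟨w, hwij, hwlt⟩ := hf.exists_weight hV hh hh'
  have hi : i ∈ Set.Icc 1 n := hV ▸ hf.1
  have hj : j ∈ Set.Icc 1 n := hV ▸ hf.2.1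
  have hw : ∀ A : H.edgeSet, ∀ k ∈ A.1, w k ≤ w (h A : ℕ) := by
    intro A k hk
    by_cases hne : k = h A
    · rw [hne]
    · by_cases hc : k = i ∧ (h A : ℕ) = j
      · rw [hc.1, hc.2, hwij]
      · exact (hwlt A k hk hne hc).le
  have hw' : ∀ A, w (h' A : ℕ) = w (h A : ℕ) := fun A => by
    rw [hf.2.2.2.2 A]
    split_ifs with hc
    · rw [hwij, hc.1]
    · rfl
  let m : H.edgeSet → ℝ := fun A => if (h A : ℕ) = j ∧ i ∈ A.1 then 1 else 0
  have hdiff : ∀ A, unitVec n (h' A : ℕ) =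
      unitVec n (h A : ℕ) + m A • (unitVec n i - unitVec n j) := fun A => by
    rw [hf.2.2.2.2 A]
    by_cases hc : (h A : ℕ) = j ∧ i ∈ A.1
    · simp [m, hc]
    · simp [m, hc]
  have hδ : inDegree n h' = inDegree n h + (∑ A, m A) • (unitVec n i - unitVec n j) := by
    rw [inDegree_eq_sum, inDegree_eq_sum, Finset.sum_smul, ← Finset.sum_add_distrib]
    exact Finset.sum_congr rfl fun A _ => hdiff A
  have hm : 0 < ∑ A, m A := by
    obtain ⟨A, hj, hiA, -⟩ := hf.exists_edge
    refine Finset.sum_pos' (fun B _ => ?_) ⟨A, Finset.mem_univ A, by simp [m, hj, hiA]⟩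
    simp only [m]
    split_ifs <;> norm_num
  refine ⟨functional n w, Set.Subset.antisymm ?_ ?_⟩
  · rintro _ ⟨a, b, ha, hb, hab, rfl⟩
    refine ⟨mem_polytope_iff.2 ⟨fun A => a • unitVec n (h A : ℕ) + b • unitVec n (h' A : ℕ),
      fun A => (convex_convexHull ℝ _) (unitVec_head_mem hV h A) (unitVec_head_mem hV h' A)
        ha hb hab, ?_⟩, fun y hy => ?_⟩
    · rw [Finset.sum_add_distrib, ← Finset.smul_sum, ← Finset.smul_sum, inDegree_eq_sum,
        inDegree_eq_sum]
    · rw [map_add, map_smul, map_smul, functional_inDegree hV h', Finset.sum_congr rfl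
        fun A _ => hw' A, ← functional_inDegree hV h, ← add_smul, hab, one_smul]
      exact le_functional_inDegree hV hw hy
  · rintro x ⟨hx, hmax⟩
    obtain ⟨y, hy, rfl, hyk⟩ :=
      exists_sum_of_functional_eq hV hw hx (hmax _ (inDegree_mem_polytope hV h))
    have hy' : ∀ A, ∃ t : ℝ, 0 ≤ t ∧ t ≤ m A ∧
        y A = unitVec n (h A : ℕ) + t • (unitVec n i - unitVec n j) := by
      intro A
      by_cases hc : (h A : ℕ) = j ∧ i ∈ A.1
      · obtain ⟨t, h₀, h₁, ht⟩ := eq_add_smul_of_mem_simplex (hy A) hi hj hf.2.2.1 fun k hk => by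
          by_contra hk'
          rw [not_or] at hk'
          exact (hwlt A k (hyk A k hk).1 (fun e => hk'.2 (e.trans hc.1)) fun e => hk'.1 e.1).ne
            (hyk A k hk).2
        exact ⟨t, h₀, by simpa [m, hc] using h₁, by rw [ht, hc.1]⟩
      · refine ⟨0, le_rfl, by simp [m, hc], ?_⟩
        rw [zero_smul, add_zero]
        refine eq_unitVec_of_mem_simplex (hy A) (head_mem_Icc hV h A) fun k hk => ?_
        by_contra hk'
        exact (hwlt A k (hyk A k hk).1 hk' fun e => hc ⟨e.2, e.1 ▸ (hyk A k hk).1⟩).ne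
          (hyk A k hk).2
    choose t ht₀ ht₁ ht using hy'
    have hsum : ∑ A, y A = inDegree n h + (∑ A, t A) • (unitVec n i - unitVec n j) := by
      rw [inDegree_eq_sum, Finset.sum_smul, ← Finset.sum_add_distrib]
      exact Finset.sum_congr rfl fun A _ => ht A
    rw [segment_eq_image']
    -- The denominator is the number of flipped hyperedges, which is the length of the segment in
    -- units of $e_i - e_j$.
    refine ⟨(∑ A, t A) / ∑ A, m A, ⟨div_nonneg (Finset.sum_nonneg fun A _ => ht₀ A) hm.le,
      (div_le_one hm).2 (Finset.sum_le_sum fun A _ => ht₁ A)⟩, ?_⟩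
    simp only
    rw [hsum, hδ, add_sub_cancel_left, smul_smul, div_mul_cancel₀ _ hm.ne']

end Edges

/-- The in-degree sequences give an isomorphism from the flip graph onto the skeleton. -/
theorem exists_iso_skeleton {n : ℕ} {H : Hypergraph ℕ} (hV : H.vertexSet = Set.Icc 1 n) :
    ∃ e : flipGraph H ≃g skeleton (polytope n H), ∀ h : AO H, (e h).1 = inDegree n h.1 := by
  have := finite_edgeSet hV
  have := Fintype.ofFinite H.edgeSet
  let f : AO H → (polytope n H).extremePoints ℝ := fun h =>
    ⟨inDegree n h.1, inDegree_mem_extremePoints hV h.2⟩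
  have hf : Function.Bijective f := by
    constructor
    · exact fun h h' e => Subtype.ext (inDegree_injective hV h.2 (congrArg Subtype.val e))
    · rintro ⟨x, hx⟩
      obtain ⟨h, hh, he⟩ := exists_inDegree_eq hV hx
      exact ⟨⟨h, hh⟩, Subtype.ext he⟩
  refine ⟨⟨Equiv.ofBijective f hf, fun {h h'} => ?_⟩, fun h => rfl⟩
  change f h ≠ f h' ∧ IsExposed ℝ (polytope n H) (segment ℝ (inDegree n h.1) (inDegree n h'.1)) ↔
    (flipGraph H).Adj h h'
  rw [hf.1.ne_iff, flipGraph, SimpleGraph.fromRel_adj]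
  refine and_congr_right fun hne => ⟨fun hexp => ?_, ?_⟩
  · exact .inl (exists_isPairFlip_of_isExposed hV (fun e => hne (Subtype.ext e)) hexp)
  · rintro (⟨i, j, hflip⟩ | ⟨i, j, hflip⟩)
    · exact hflip.isExposed hV h.2 h'.2
    · rw [segment_symm]
      exact hflip.isExposed hV h'.2 h.2

/-! ### Hamilton paths and the conclusion -/

open Classical in
theorem isHamiltonPath_map {V V' : Type*} {G : SimpleGraph V} {G' : SimpleGraph V'} (e : G ≃g G')
    {l : List V} (h : IsHamiltonPath G l) : IsHamiltonPath G' (l.map e) := by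
  obtain ⟨u, v, p, hp, rfl⟩ := h
  exact ⟨_, _, p.map e.toHom, hp.map _ e.bijective, p.support_map _⟩

open Classical in
theorem isHamiltonPath_of_isChain {V : Type*} {G : SimpleGraph V} {l : List V} (hne : l ≠ [])
    (hchain : l.IsChain G.Adj) (hnd : l.Nodup) (hmem : ∀ v, v ∈ l) : IsHamiltonPath G l := by
  have hs := SimpleGraph.Walk.support_ofSupport hne hchain
  refine ⟨_, _, .ofSupport l hne hchain, ?_, hs⟩
  intro v
  rw [hs]
  exact List.count_eq_one_of_mem hnd (hmem v)

end HypergraphGray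

theorem mainTheorem1 (n : ℕ) (H : Hypergraph ℕ) (hV : H.vertexSet = Set.Icc 1 n)
    (hne : ∀ A ∈ H.edgeSet, A.Nonempty) (hH : HypergraphGray.IsHEO n H) :
    ∃ hs : List (HypergraphGray.AO H),
      (∀ out : List (List ℕ),
        HypergraphGray.IsAlgorithmJOutput (HypergraphGray.encodings n H)
          (HypergraphGray.idPerm n) out ↔ out = hs.map (HypergraphGray.encode n)) ∧
      HypergraphGray.IsHamiltonPath (HypergraphGray.flipGraph H) hs ∧
      ∃ e : HypergraphGray.flipGraph H ≃g
          HypergraphGray.skeleton (HypergraphGray.polytope n H),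
        (∀ h : HypergraphGray.AO H, (e h).1 = HypergraphGray.inDegree n h.1) ∧
        HypergraphGray.IsHamiltonPath
          (HypergraphGray.skeleton (HypergraphGray.polytope n H)) (hs.map e) := by
  open HypergraphGray in
  obtain ⟨out, hJ, hmem, hchain⟩ := exists_isAlgorithmJOutput hV hne hH
  have hinj := encode_injective hV hH
  -- Every visited permutation is an encoding, so the run lifts to a list of orientations;
  -- injectivity of the encoding then transfers the flips and completeness to this list.
  obtain ⟨hs, rfl⟩ : ∃ hs : List (AO H), out = hs.map (encode n) := by
    have : ∀ x ∈ out, x ∈ Set.range (fun h : AO H => encode n h) := fun x hx => (hmem x).1 hx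
    rw [← Set.mem_ofPred_eq (p := fun out : List (List ℕ) => ∀ x ∈ out, x ∈ _),
      ← Set.range_list_map] at this
    obtain ⟨hs, e⟩ := this
    exact ⟨hs, e.symm⟩
  have hnd : ∀ π ∈ encodings n H, π.Nodup := by
    rintro _ ⟨h, rfl⟩
    exact (encode_perm n h).nodup_iff.2 List.nodup_range'
  have hham : IsHamiltonPath (flipGraph H) hs := by
    refine isHamiltonPath_of_isChain ?_ ?_ (List.Nodup.of_map _ hJ.nodup) fun h => ?_
    · rintro rfl
      simpa using hJ.2.1
    · refine (List.isChain_map _).1 hchain |>.imp ?_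
      rintro h h' ⟨k, k', hk, hk', hadj⟩
      rwa [← hinj hk, ← hinj hk']
    · obtain ⟨k, hk, he⟩ := List.mem_map.1 ((hmem _).2 ⟨h, rfl⟩)
      rwa [← hinj he]
  obtain ⟨e, he⟩ := exists_iso_skeleton hV
  refine ⟨hs, fun out => ⟨fun h => h.unique hnd hJ, ?_⟩, hham, e, he, isHamiltonPath_map e hham⟩
  rintro rfl
  exact hJ
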